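/- **Setting.** Let $\alpha>0$, $\lambda\in\{-1,0,1\}$, and let $(\eta_m)_{m\ge1}$ be nonnegative reals with $\sum_m\eta_m<\infty$. Put $e_m(x)=\sqrt2\sin(m\pi x)$, $(f,g)=\int_0^1 f\bar g\,dx$, $V_N=\mathrm{span}_{\mathbb C}\{e_1,\dots,e_N\}$ (with its Borel $\sigma$-algebra) and $\pi_N f=\sum_{m=1}^N (f,e_m)e_m$. Let $\beta_m=\beta_m^1+\mathbf i\beta_m^2$ $(m\ge1)$ be independent $\mathbb C$-valued Wiener processes with respect to a filtration $(\mathcal F_t)_{t\ge0}$ on a probability space (all $\beta_m^i$ are independent standard real Brownian motions, adapted, with increments after time $s$ jointly independent of $\mathcal F_s$). Write $\pi_NQ^{1/2}\delta W_k=\sum_{m=1}^N\sqrt{\eta_m}\,e_m\,\bigl(\beta_m(k\tau)-\beta_m((k-1)\tau)\bigr)$. For $u_0\in L^2(0,1)$ and a time step $\tau>0$ consider the fully discrete scheme $$u_N^{k}-e^{-\alpha\tau}u_N^{k-1}=\Bigl(\mathbf i\Delta u_N^{k}+\mathbf i\lambda\,\pi_N\Bigl(\tfrac{|u_N^{k}|^2+|e^{-\alpha\tau}u_N^{k-1}|^2}{2}\,u_N^{k}\Bigr)\Bigr)\tau+\pi_NQ^{1/2}\delta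 W_k,\qquad u_N^0=\pi_Nu_0, \tag{BE}$$ for $V_N$-valued, $(\mathcal F_{k\tau})_k$-adapted $(u_N^k)_{k\in\mathbb N}$. **Theorem.** For every $N\ge1$ there is $\tau_0>0$ (depending on $\alpha,\lambda,(\eta_m)$ and $N$, and not on $N$ if $\lambda\in\{-1,0\}$) such that, whenever $\eta_m>0$ for $1\le m\le N$ and $0<\tau<\tau_0$: 1. For every previous state in $V_N$ and every noise increment in $V_N$, the equation of one step of (BE) has exactly one solution in $V_N$. There is a Markov kernel $P_1$ on $V_N$ such that $P_1(v,G)$ is the probability that the state after one step from the deterministic state $v$ lies in $G$. For all probability spaces, filtrations, Wiener processes and $u_0\in L^2(0,1)$ as above, (BE) has an adapted solution, and every adapted solution is a Markov chain with transition kernel $P_1$: $P(u_N^{k+1}\in G\mid\mathcal F_{k\tau})=P_1(u_N^k,G)$ a.s. for all $k$ and all Borel $G\subset V_N$. 2. The chain has a unique invariant probability measure $\mu_N^\tau$, i.e. there is exactly one Borel probability measure $\mu_N^\tau$ on $V_N$ with $\int P_1(v,G)\,\mu_N^\tau(dv)=\mu_N^\tau(G)$ for all Borel $G$. 3. The chain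 is ergodic: with $P^k\varphi(v)=\int\varphi(z)\,P_k(v,dz)$, where $P_k$ is the $k$-step transition kernel, for every $\varphi\in L^2(V_N,\mu_N^\tau)$ $$\lim_{n\to\infty}\frac1n\sum_{k=0}^{n-1}P^k\varphi=\int_{V_N}\varphi\,d\mu_N^\tau\quad\text{in }L^2(V_N,\mu_N^\tau).$$ -/

import Mathlib

open MeasureTheory ProbabilityTheory Filter Topology
open scoped NNReal ENNReal ProbabilityTheory ComplexConjugate

noncomputable section

namespace DampedNLS

/-- The Dirichlet eigenfunctions `√2 sin(n π x)` of the Laplacian on `(0,1)`, numbered from `0`: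
`sineMode m` is the eigenfunction with `n = m + 1`. -/
def sineMode (m : ℕ) (x : ℝ) : ℂ :=
  ((Real.sqrt 2 * Real.sin ((m + 1) * Real.pi * x) : ℝ) : ℂ)

/-- The spectral Galerkin space `V_N`, the complex span of the first `N` eigenfunctions. Its
elements are functions (given by the same formula on all of `ℝ`), and its σ-algebra, inherited
from `ℝ → ℂ`, is generated by the point evaluations; since `V_N` is finite-dimensional and
the evaluations separate its points, this is its Borel σ-algebra. -/
def galerkinSpace (N : ℕ) : Submodule ℂ (ℝ → ℂ) :=
  Submodule.span ℂ (Set.range fun m : Fin N => sineMode m)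

/-- The `m`-th eigenfunction as an element of `V_N`. -/
def modeVec (N : ℕ) (m : Fin N) : galerkinSpace N :=
  ⟨sineMode m, Submodule.subset_span ⟨m, rfl⟩⟩

/-- The projection `π_N f = ∑ₘ (f, eₘ) eₘ`, with `(f, g) = ∫₀¹ f ḡ`. -/
def galerkinProj (N : ℕ) (f : ℝ → ℂ) : galerkinSpace N :=
  ∑ m : Fin N, (∫ x in (0 : ℝ)..1, f x * conj (sineMode m x)) • modeVec N m

/-- The truncated coloured noise `∑ₘ √ηₘ gₘ eₘ` built from the complex coefficients `gₘ`. -/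
def galerkinNoise (η : ℕ → ℝ) (N : ℕ) (g : Fin N → ℂ) : galerkinSpace N :=
  ∑ m : Fin N, ((Real.sqrt (η m) : ℂ) * g m) • modeVec N m

/-- One step of the modified implicit Euler scheme: `u` is a solution of
`u - e^{-ατ} v = (i Δ u + i λ π_N ((|u|² + |e^{-ατ} v|²) / 2 · u)) τ + w` on `[0,1]`, where `v` is
the previous state and `w` is the noise increment. -/
def IsEulerStep (α lam : ℝ) (τ : ℝ≥0) (N : ℕ) (v w u : galerkinSpace N) : Prop :=
  ∀ x ∈ Set.Icc (0 : ℝ) 1,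
    (u : ℝ → ℂ) x - (Real.exp (-α * τ) : ℂ) * (v : ℝ → ℂ) x =
      (Complex.I * iteratedDeriv 2 (u : ℝ → ℂ) x +
        Complex.I * (lam : ℂ) *
          (galerkinProj N (fun y =>
            ((‖(u : ℝ → ℂ) y‖ ^ 2 + ‖(Real.exp (-α * τ) : ℂ) * (v : ℝ → ℂ) y‖ ^ 2 : ℝ) : ℂ) / 2 *
              (u : ℝ → ℂ) y) : ℝ → ℂ) x) * ((τ : ℝ) : ℂ) +
      (w : ℝ → ℂ) x

/-- The law of a `ℂ`-valued Wiener increment over a time of length `τ`: independent real and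
imaginary parts, both centred Gaussian with variance `τ`. -/
def complexIncrementLaw (τ : ℝ≥0) : Measure ℂ :=
  ((gaussianReal 0 τ).prod (gaussianReal 0 τ)).map Complex.measurableEquivRealProd.symm

/-- The law on `V_N` of the noise increment `π_N Q^{1/2} (W(t + τ) - W(t))`. -/
def noiseLaw (η : ℕ → ℝ) (τ : ℝ≥0) (N : ℕ) : Measure (galerkinSpace N) :=
  (Measure.pi fun _ : Fin N => complexIncrementLaw τ).map (galerkinNoise η N)

/-- `κ` is the one-step transition kernel of the scheme: `κ v G` is the probability that the state
after one step lies in `G`, when the present state is the deterministic `v`. -/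
def IsTransitionKernel (α lam : ℝ) (η : ℕ → ℝ) (τ : ℝ≥0) (N : ℕ)
    (κ : Kernel (galerkinSpace N) (galerkinSpace N)) : Prop :=
  ∀ v : galerkinSpace N, ∀ G : Set (galerkinSpace N), MeasurableSet G →
    κ v G = noiseLaw η τ N {w | ∃ u ∈ G, IsEulerStep α lam τ N v w u}

/-- The real (`true`) and imaginary (`false`) parts of a family of `ℂ`-valued processes. -/
def realComponent {Ω : Type*} (β : ℕ → ℝ≥0 → Ω → ℂ) (p : ℕ × Bool) (t : ℝ≥0) (ω : Ω) : ℝ :=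
  if p.2 then (β p.1 t ω).re else (β p.1 t ω).im

/-- `β` is a family of independent `ℂ`-valued Wiener processes associated to the filtration `ℱ`:
the real and imaginary parts are standard real Brownian motions, all independent of each other,
and the family is adapted with increments after time `s` independent of `ℱ s`. -/
structure IsWienerFamily {Ω : Type*} [mΩ : MeasurableSpace Ω] (P : Measure Ω)
    (ℱ : Filtration ℝ≥0 mΩ) (β : ℕ → ℝ≥0 → Ω → ℂ) : Prop where
  brownian : ∀ p : ℕ × Bool, IsBrownianReal (realComponent β p) P
  independent : iIndepFun (fun (p : ℕ × Bool) (ω : Ω) (t : ℝ≥0) => realComponent β p t ω) P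
  adapted : ∀ (m : ℕ) (t : ℝ≥0), Measurable[ℱ t] (β m t)
  increment_indep : ∀ s t : ℝ≥0, s ≤ t →
    Indep (MeasurableSpace.comap (fun (ω : Ω) (m : ℕ) => β m t ω - β m s ω) inferInstance)
      (ℱ s) P

/-- `u` is an adapted `V_N`-valued solution of the fully discrete scheme with time step `τ`, driven
by the Wiener processes `β`, with initial value `π_N u₀`. -/
structure IsSchemeSolution (α lam : ℝ) (η : ℕ → ℝ) (τ : ℝ≥0) (N : ℕ)
    {Ω : Type*} [mΩ : MeasurableSpace Ω] (P : Measure Ω) (ℱ : Filtration ℝ≥0 mΩ)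
    (β : ℕ → ℝ≥0 → Ω → ℂ) (u₀ : ℝ → ℂ) (u : ℕ → Ω → galerkinSpace N) : Prop where
  adapted : ∀ k : ℕ, Measurable[ℱ (k * τ)] (u k)
  init : ∀ᵐ ω ∂P, u 0 ω = galerkinProj N u₀
  step : ∀ k : ℕ, ∀ᵐ ω ∂P, IsEulerStep α lam τ N (u k ω)
    (galerkinNoise η N fun m => β m ((k + 1 : ℕ) * τ) ω - β m (k * τ) ω) (u (k + 1) ω)

/-- `κ` is the transition kernel of the Markov chain `u` with respect to the filtration
`(ℱ (k τ))ₖ`: almost surely, `P (u (k + 1) ∈ G | ℱ (k τ)) = κ (u k) G`. -/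
def IsMarkovChainWith {V Ω : Type*} [MeasurableSpace V] [mΩ : MeasurableSpace Ω] (P : Measure Ω)
    (ℱ : Filtration ℝ≥0 mΩ) (τ : ℝ≥0) (κ : Kernel V V) (u : ℕ → Ω → V) : Prop :=
  ∀ k : ℕ, ∀ G : Set V, MeasurableSet G →
    P⟦u (k + 1) ⁻¹' G | ℱ (k * τ)⟧ =ᵐ[P] fun ω => (κ (u k ω)).real G

/-- Ergodicity of the chain with kernel `κ` and invariant measure `μ`: for every `φ ∈ L²(V, μ)` the
time averages `(1/n) ∑_{k<n} P^k φ` converge to `∫ φ dμ` in `L²(V, μ)`, where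
`P^k φ (v) = ∫ φ(z) κ^k(v, dz)`. -/
def IsErgodicFor {V : Type*} [MeasurableSpace V] (κ : Kernel V V) (μ : Measure V) : Prop :=
  ∀ φ : V → ℝ, MemLp φ 2 μ →
    Tendsto (fun n : ℕ => eLpNorm
      (fun v => (1 / (n : ℝ)) * (∑ k ∈ Finset.range n, ∫ z, φ z ∂((κ ^ k) v)) - (∫ z, φ z ∂μ)) 2 μ)
      atTop (𝓝 0)

end DampedNLS

end

/-! In sine coefficients one step reads `eulerMap b c = s • b + w` with `s = exp (-α τ)`, where `c`
is the new state. Everything rests on pairing this implicit map with its argument.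

The cubic term satisfies a sector condition: for the difference of two values paired with the
difference of the arguments, the imaginary part is dominated by the real part
(`abs_im_cubic_sub_le`). Multiplication by `i` swaps the two parts, so the imaginary part of the
pairing of `eulerMap b c - eulerMap b d` with `c - d` controls the nonlinear contribution to the
real part. Hence `eulerMap b` is antilipschitz uniformly in `b` (`eulerMap_antilipschitz`). Only for
`lam = 1` does the Laplacian have the wrong sign in this argument, which costs `τ (N π)² < 1`. A
`C¹` antilipschitz self-map of a finite-dimensional space is bijective with invertible derivative,
so a step is uniquely solvable, depends continuously on the data, and preserves Lebesgue null sets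
in both directions.

Since the noise has a law equivalent to Lebesgue measure, all transition laws are equivalent to a
single measure (`coeffKernel_apply_eq_zero_iff`). This gives uniqueness of the invariant law,
because two different ones would produce mutually singular invariant measures both dominating it
(`invariant_unique`). It also makes the fixed functions of the Markov operator constant, so von
Neumann's mean ergodic theorem identifies the limit of the time averages
(`isErgodicFor_of_equivalent`). Existence is Krylov–Bogoliubov: pairing `eulerMap b c` with `c`
itself leaves `‖c‖²` as real part, whence `‖c‖ ≤ s ‖b‖ + ‖w‖` with `s < 1` (`norm_le_norm_eulerMap`,
`exists_invariant_of_feller`). The Markov property comes from independence of the increments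
(`condExp_randomMap`). -/

namespace DampedNLS

/-! ### Invariant measures of kernels with equivalent transition laws -/

section MarkovTheory

variable {V : Type*} [MeasurableSpace V] {κ : Kernel V V}

lemma integral_bind_kernel {μ : Measure V} {f : V → ℝ} (hf : Integrable f (μ.bind κ)) :
    ∫ z, f z ∂(μ.bind κ) = ∫ v, ∫ z, f z ∂(κ v) ∂μ := by
  rw [Measure.comp_eq_comp_const_apply] at hf ⊢
  rw [Kernel.integral_comp hf]
  simp

/-- A `σ`-null set is `κ v`-null for `σ`-almost every `v`, and one such `v` is enough. No
normalisation of `σ` is required, so that differences of invariant measures are covered. -/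
lemma absolutelyContinuous_of_invariant {ℓ σ : Measure V} (h : ∀ v, ℓ ≪ κ v)
    (hσ : Kernel.Invariant κ σ) (h0 : σ ≠ 0) : ℓ ≪ σ := by
  refine Measure.AbsolutelyContinuous.mk fun s hs hs0 => ?_
  rw [← hσ.def, Measure.bind_apply hs κ.measurable.aemeasurable,
    lintegral_eq_zero_iff (κ.measurable_coe hs)] at hs0
  have : NeBot (ae σ) := ae_neBot.2 h0
  obtain ⟨v, hv⟩ := hs0.exists
  exact h v hv

lemma absolutelyContinuous_invariant {ℓ σ : Measure V} (h : ∀ v, κ v ≪ ℓ)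
    (hσ : Kernel.Invariant κ σ) : σ ≪ ℓ := by
  refine Measure.AbsolutelyContinuous.mk fun s hs hs0 => ?_
  rw [← hσ.def, Measure.bind_apply hs κ.measurable.aemeasurable]
  simp [fun v => h v hs0]

lemma invariant_pow (hμ : Kernel.Invariant κ μ) (n : ℕ) : Kernel.Invariant (κ ^ n) μ := by
  induction n with
  | zero =>
    rw [pow_zero]
    exact Measure.bind_dirac
  | succ n ih =>
    rw [pow_succ']
    exact hμ.comp ih

variable [IsMarkovKernel κ]

lemma isMarkovKernel_pow (κ : Kernel V V) [IsMarkovKernel κ]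
    (n : ℕ) : IsMarkovKernel (κ ^ n) := by
  induction n with
  | zero => rw [pow_zero]; exact inferInstanceAs (IsMarkovKernel Kernel.id)
  | succ n ih => rw [pow_succ']; exact inferInstanceAs (IsMarkovKernel (κ ∘ₖ (κ ^ n)))

lemma integral_pow_succ {κ : Kernel V V} {v : V} {n : ℕ}
    {f : V → ℝ} (hf : Integrable f ((κ ^ (n + 1)) v)) :
    ∫ z, f z ∂((κ ^ (n + 1)) v) = ∫ y, ∫ z, f z ∂(κ y) ∂((κ ^ n) v) := by
  rw [pow_succ'] at hf ⊢
  exact Kernel.integral_comp hf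

lemma bind_univ_eq (μ : Measure V) : μ.bind κ Set.univ = μ Set.univ := by
  rw [Measure.bind_apply MeasurableSet.univ κ.measurable.aemeasurable]
  simp

/-- The truncated difference is the least `ρ` with `μ ≤ ρ + ν`. Its image under `κ` has the same
property, hence dominates it; since `κ` preserves total mass, the two agree. -/
lemma invariant_sub {μ ν : Measure V} [IsFiniteMeasure μ] [IsFiniteMeasure ν]
    (hμ : Kernel.Invariant κ μ) (hν : Kernel.Invariant κ ν) : Kernel.Invariant κ (μ - ν) := by
  have hle : μ - ν ≤ (μ - ν).bind κ := by
    apply Measure.sub_le_of_le_add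
    calc μ = μ.bind κ := hμ.def.symm
      _ ≤ ((μ - ν) + ν).bind κ := by
        refine Measure.le_iff.2 fun s hs => ?_
        rw [Measure.bind_apply hs κ.measurable.aemeasurable,
          Measure.bind_apply hs κ.measurable.aemeasurable]
        exact lintegral_mono' (Measure.sub_le_iff_le_add.1 le_rfl) le_rfl
      _ = (μ - ν).bind κ + ν.bind κ := by
        ext s hs
        rw [Measure.add_apply, Measure.bind_apply hs κ.measurable.aemeasurable,
          Measure.bind_apply hs κ.measurable.aemeasurable,
          Measure.bind_apply hs κ.measurable.aemeasurable, lintegral_add_measure]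
      _ = (μ - ν).bind κ + ν := by rw [hν.def]
  exact (Measure.eq_of_le_of_measure_univ_eq hle (bind_univ_eq _).symm).symm

/-- A Markov kernel all of whose transition laws are equivalent to one measure has at most one
invariant probability measure. -/
theorem invariant_unique {ℓ : Measure V} (h1 : ∀ v, κ v ≪ ℓ) (h2 : ∀ v, ℓ ≪ κ v)
    {μ ν : Measure V} [IsProbabilityMeasure μ] [IsProbabilityMeasure ν]
    (hμ : Kernel.Invariant κ μ) (hν : Kernel.Invariant κ ν) : μ = ν := by
  have key : ∀ {μ ν : Measure V} [IsProbabilityMeasure μ] [IsProbabilityMeasure ν],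
      μ - ν = 0 → μ = ν := by
    intro μ ν _ _ h
    refine Measure.eq_of_le_of_measure_univ_eq ?_ (by simp)
    have : μ ≤ μ - ν + ν := Measure.sub_le_iff_le_add.1 le_rfl
    rwa [h, zero_add] at this
  by_cases ha : μ - ν = 0
  · exact key ha
  by_cases hb : ν - μ = 0
  · exact (key hb).symm
  exfalso
  -- Both parts of the Jordan decomposition are nonzero and invariant, so `ℓ` is absolutely
  -- continuous with respect to two mutually singular measures and vanishes; but `ℓ` dominates the
  -- probability measures `κ v`.
  have hac := absolutelyContinuous_of_invariant h2 (invariant_sub hμ hν) ha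
  have hbc := absolutelyContinuous_of_invariant h2 (invariant_sub hν hμ) hb
  have hs : (μ - ν) ⟂ₘ (ν - μ) := Measure.mutually_singular_measure_sub
  have hl : ℓ = 0 := Measure.MutuallySingular.self_iff ℓ |>.1 ((hs.mono_ac hac hbc))
  have hv : Nonempty V := nonempty_of_isProbabilityMeasure μ
  have := h1 hv.some
  rw [hl, Measure.absolutelyContinuous_zero_iff] at this
  exact IsProbabilityMeasure.ne_zero _ this

end MarkovTheory

/-! ### Mean ergodic theorem in `L²` -/

section Ergodic

variable {V : Type*} [MeasurableSpace V] {κ : Kernel V V} [IsMarkovKernel κ]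
  {μ : Measure V} [IsProbabilityMeasure μ]

lemma measurePreserving_fst : MeasurePreserving Prod.fst (μ ⊗ₘ κ) μ :=
  ⟨measurable_fst, Measure.fst_compProd μ κ⟩

lemma measurePreserving_snd (hμ : Kernel.Invariant κ μ) :
    MeasurePreserving Prod.snd (μ ⊗ₘ κ) μ :=
  ⟨measurable_snd, (Measure.snd_compProd μ κ).trans hμ⟩

/-- The Markov operator `φ ↦ ∫ φ dκ` on `L²(μ)`, built from the two coordinate isometries
`L²(μ) → L²(μ ⊗ κ)`. -/
noncomputable def markovOperator (hμ : Kernel.Invariant κ μ) : Lp ℝ 2 μ →L[ℝ] Lp ℝ 2 μ :=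
  (ContinuousLinearMap.adjoint (Lp.compMeasurePreservingₗᵢ ℝ Prod.fst
    (measurePreserving_fst (κ := κ) (μ := μ)) (E := ℝ) (p := 2)).toContinuousLinearMap).comp
  (Lp.compMeasurePreservingₗᵢ ℝ Prod.snd (measurePreserving_snd hμ)).toContinuousLinearMap

/-- For a stationary pair `(X₀, X₁)` of law `μ ⊗ₘ κ` this is `⟨Tφ, ψ⟩ = E[φ(X₁) ψ(X₀)]`. -/
lemma inner_markovOperator (hμ : Kernel.Invariant κ μ) (φ ψ : Lp ℝ 2 μ) :
    inner ℝ (markovOperator hμ φ) ψ =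
      inner ℝ (Lp.compMeasurePreservingₗᵢ ℝ Prod.snd (measurePreserving_snd hμ) φ)
        (Lp.compMeasurePreservingₗᵢ ℝ Prod.fst (measurePreserving_fst (κ := κ)) ψ) := by
  rw [markovOperator, ContinuousLinearMap.comp_apply, ContinuousLinearMap.adjoint_inner_left]
  rfl

lemma norm_markovOperator_le (hμ : Kernel.Invariant κ μ) : ‖markovOperator hμ‖ ≤ 1 := by
  refine (ContinuousLinearMap.opNorm_comp_le _ _).trans ?_
  refine mul_le_one₀ ?_ (norm_nonneg _) (LinearIsometry.norm_toContinuousLinearMap_le _)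
  rw [LinearIsometryEquiv.norm_map]
  exact LinearIsometry.norm_toContinuousLinearMap_le _

lemma integrable_of_memLp_two {ν : Measure V} [IsFiniteMeasure ν] (φ : Lp ℝ 2 ν) :
    Integrable φ ν := (Lp.memLp φ).integrable (by norm_num)

lemma integrable_integral_kernel (hμ : Kernel.Invariant κ μ) {φ : V → ℝ} (hφ : Integrable φ μ) :
    Integrable (fun v => ∫ z, φ z ∂(κ v)) μ := by
  have h := ((measurePreserving_snd hμ).integrable_comp hφ.aestronglyMeasurable).2 hφ
  simpa [Measure.compProd] using h.integral_compProd

lemma markovOperator_ae_eq (hμ : Kernel.Invariant κ μ) (φ : Lp ℝ 2 μ) :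
    markovOperator hμ φ =ᵐ[μ] fun v => ∫ z, φ z ∂(κ v) := by
  have hφ := integrable_of_memLp_two φ
  have hφ2 := ((measurePreserving_snd hμ).integrable_comp hφ.aestronglyMeasurable).2 hφ
  refine Integrable.ae_eq_of_forall_setIntegral_eq _ _ (integrable_of_memLp_two _)
    (integrable_integral_kernel hμ hφ) fun s hs _ => ?_
  have h1 : inner ℝ (markovOperator hμ φ) (indicatorConstLp 2 hs (measure_ne_top μ s) (1 : ℝ)) =
      ∫ v in s, markovOperator hμ φ v ∂μ := by
    rw [real_inner_comm, L2.inner_indicatorConstLp_one]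
  rw [← h1, inner_markovOperator, L2.inner_def]
  have h2 : ∀ᵐ p ∂(μ ⊗ₘ κ), inner ℝ
      (Lp.compMeasurePreservingₗᵢ ℝ Prod.snd (measurePreserving_snd hμ) φ p)
      (Lp.compMeasurePreservingₗᵢ ℝ Prod.fst (measurePreserving_fst (κ := κ))
        (indicatorConstLp 2 hs (measure_ne_top μ s) (1 : ℝ)) p) =
      (s ×ˢ Set.univ).indicator (fun p : V × V => φ p.2) p := by
    filter_upwards [Lp.coeFn_compMeasurePreserving φ (measurePreserving_snd hμ),
      Lp.coeFn_compMeasurePreserving (indicatorConstLp 2 hs (measure_ne_top μ s) (1 : ℝ))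
        (measurePreserving_fst (κ := κ)),
      (measurePreserving_fst (κ := κ)).quasiMeasurePreserving.ae
        (indicatorConstLp_coeFn (p := 2) (hs := hs) (hμs := measure_ne_top μ s) (c := (1 : ℝ)))]
      with p h3 h4 h5
    change inner ℝ (Lp.compMeasurePreserving Prod.snd _ φ p)
      (Lp.compMeasurePreserving Prod.fst _ _ p) = _
    rw [h3, h4, Function.comp_apply, Function.comp_apply, h5]
    by_cases hp : p.1 ∈ s <;> simp [hp]
  rw [integral_congr_ae h2, integral_indicator (hs.prod MeasurableSet.univ),
    Measure.setIntegral_compProd (f := fun p : V × V => φ p.2) hs MeasurableSet.univ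
      hφ2.integrableOn]
  simp

lemma iterate_markovOperator_ae_eq (hμ : Kernel.Invariant κ μ) {φ : V → ℝ} (hφ : MemLp φ 2 μ)
    (n : ℕ) :
    (markovOperator hμ)^[n] (hφ.toLp φ) =ᵐ[μ] fun v => ∫ z, φ z ∂((κ ^ n) v) := by
  induction n with
  | zero =>
    simp only [Function.iterate_zero, id_eq, pow_zero]
    -- `φ` is only almost everywhere measurable, so integration against a Dirac mass goes through a
    -- strongly measurable representative.
    have hid : ∀ v, (∀ᵐ z ∂(Kernel.id v), φ z = hφ.1.mk φ z) →
        ∫ z, φ z ∂(Kernel.id v) = hφ.1.mk φ v := fun v hv => by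
      rw [integral_congr_ae hv, Kernel.id_apply, integral_dirac' _ _ hφ.1.stronglyMeasurable_mk]
    have h0 : ∀ᵐ v ∂μ, ∀ᵐ z ∂((Kernel.id : Kernel V V) v), φ z = hφ.1.mk φ z := by
      refine Measure.ae_ae_of_ae_comp ?_
      rw [show (Kernel.id : Kernel V V) ∘ₘ μ = μ from Measure.bind_dirac]
      exact hφ.1.ae_eq_mk
    filter_upwards [hφ.coeFn_toLp, h0, hφ.1.ae_eq_mk] with v h1 h2 h3
    rw [h1, h3]
    exact (hid v h2).symm
  | succ n ih =>
    rw [Function.iterate_succ_apply']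
    refine (markovOperator_ae_eq hμ _).trans ?_
    have h0 : ∀ᵐ v ∂μ, ∀ᵐ z ∂(κ v), (markovOperator hμ)^[n] (hφ.toLp φ) z =
        ∫ y, φ y ∂((κ ^ n) z) := by
      refine Measure.ae_ae_of_ae_comp ?_
      rw [hμ.def]
      exact ih
    have hmk := isMarkovKernel_pow κ (n + 1)
    have hint : ∀ᵐ v ∂μ, Integrable φ ((κ ^ (n + 1)) v) := by
      refine Measure.ae_integrable_of_integrable_comp ?_
      rw [(invariant_pow hμ (n + 1)).def]
      exact hφ.integrable (by norm_num)
    filter_upwards [h0, hint] with v h1 h2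
    rw [integral_congr_ae h1]
    rw [pow_succ] at h2 ⊢
    exact (Kernel.integral_comp h2).symm

/-- Stationarity gives `E|φ(X₁) - φ(X₀)|² = 2‖φ‖² - 2⟨Tφ, φ⟩ = 0`. Hence for some starting point
`v`, `φ` equals `φ v` almost everywhere for `κ v`, thus for `ℓ`, thus for `μ`. -/
lemma ae_const_of_markovOperator_eq {ℓ : Measure V} (h1 : ∀ v, κ v ≪ ℓ) (h2 : ∀ v, ℓ ≪ κ v)
    (hμ : Kernel.Invariant κ μ) {φ : Lp ℝ 2 μ} (hφ : markovOperator hμ φ = φ) :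
    ∃ c : ℝ, φ =ᵐ[μ] fun _ => c := by
  have heq : Lp.compMeasurePreservingₗᵢ ℝ Prod.snd (measurePreserving_snd hμ) φ =
      Lp.compMeasurePreservingₗᵢ ℝ Prod.fst (measurePreserving_fst (κ := κ)) φ := by
    rw [← sub_eq_zero, ← norm_eq_zero, ← sq_eq_zero_iff, norm_sub_sq_real,
      ← inner_markovOperator hμ, hφ, LinearIsometry.norm_map, LinearIsometry.norm_map,
      real_inner_self_eq_norm_sq]
    ring
  have hae : ∀ᵐ p ∂(μ ⊗ₘ κ), φ p.2 = φ p.1 := by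
    filter_upwards [Lp.coeFn_compMeasurePreserving φ (measurePreserving_snd hμ),
      Lp.coeFn_compMeasurePreserving φ (measurePreserving_fst (κ := κ))] with p h3 h4
    have h5 : Lp.compMeasurePreserving Prod.snd (measurePreserving_snd hμ) φ =
      Lp.compMeasurePreserving Prod.fst (measurePreserving_fst (κ := κ)) φ := heq
    rw [h5] at h3
    exact h3.symm.trans h4
  obtain ⟨v, hv⟩ := (Measure.ae_ae_of_ae_compProd hae).exists
  exact ⟨φ v, (absolutelyContinuous_invariant h1 hμ).trans (h2 v) hv⟩

/-- The mean ergodic theorem in `L²(μ)` for a Markov kernel all of whose transition laws are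
equivalent to one measure. -/
theorem isErgodicFor_of_equivalent {ℓ : Measure V} (h1 : ∀ v, κ v ≪ ℓ) (h2 : ∀ v, ℓ ≪ κ v)
    (hμ : Kernel.Invariant κ μ) : IsErgodicFor κ μ := by
  intro φ hφ
  set T := markovOperator hμ
  set x : Lp ℝ 2 μ := hφ.toLp φ
  set S := T.eqLocus (1 : Lp ℝ 2 μ →L[ℝ] Lp ℝ 2 μ)
  let one : Lp ℝ 2 μ := indicatorConstLp 2 MeasurableSet.univ (measure_ne_top μ _) (1 : ℝ)
  have hone_ae : one =ᵐ[μ] fun _ => (1 : ℝ) := by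
    refine indicatorConstLp_coeFn.trans ?_
    rw [Set.indicator_univ]
  have hone : one ∈ S := by
    change T one = one
    refine Lp.ext ((markovOperator_ae_eq hμ one).trans ?_)
    have h0 : ∀ᵐ v ∂μ, ∀ᵐ z ∂(κ v), one z = 1 := by
      refine Measure.ae_ae_of_ae_comp ?_
      rw [hμ.def]
      exact hone_ae
    filter_upwards [h0, hone_ae] with v h3 h4
    rw [integral_congr_ae h3, h4]
    simp
  have hlim := ContinuousLinearMap.tendsto_birkhoffAverage_orthogonalProjection T
    (norm_markovOperator_le hμ) x
  set y := S.orthogonalProjectionOnto x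
  obtain ⟨c, hc⟩ := ae_const_of_markovOperator_eq h1 h2 hμ (φ := (y : Lp ℝ 2 μ)) y.2
  have hinner : ∀ f : Lp ℝ 2 μ, inner ℝ one f = ∫ v, f v ∂μ := fun f => by
    rw [L2.inner_indicatorConstLp_one, Measure.restrict_univ]
  -- The projection error is orthogonal to the fixed function `1`, so the projection keeps the mean.
  have hcφ : c = ∫ v, φ v ∂μ := by
    have h3 : inner ℝ one (x - y) = 0 :=
      S.sub_starProjection_mem_orthogonal x one hone
    rw [inner_sub_right, hinner, hinner, integral_congr_ae hc,
      integral_congr_ae hφ.coeFn_toLp, sub_eq_zero] at h3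
    simpa using h3.symm
  rw [tendsto_iff_edist_tendsto_0] at hlim
  refine hlim.congr fun n => ?_
  rw [Lp.edist_def]
  refine eLpNorm_congr_ae ?_
  have hit : ∀ᵐ v ∂μ, ∀ k : ℕ, T^[k] x v = ∫ z, φ z ∂((κ ^ k) v) :=
    ae_all_iff.2 fun k => iterate_markovOperator_ae_eq hμ hφ k
  have hsum : ∀ s : Finset ℕ, ((∑ k ∈ s, T^[k] x : Lp ℝ 2 μ) : V → ℝ) =ᵐ[μ]
      fun v => ∑ k ∈ s, T^[k] x v := fun s => by
    refine (Lp.coeFn_finsetSum _ _).trans (Eventually.of_forall fun v => ?_)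
    simp
  have hbirk : birkhoffAverage ℝ T _root_.id n x =
      (n : ℝ)⁻¹ • ∑ k ∈ Finset.range n, T^[k] x := rfl
  rw [hbirk]
  filter_upwards [hit, hsum (Finset.range n), hc,
    Lp.coeFn_smul (n : ℝ)⁻¹ (∑ k ∈ Finset.range n, T^[k] x)] with v h3 h4 h5 h6
  rw [Pi.sub_apply, h6, h5, Pi.smul_apply, h4, hcφ, smul_eq_mul, one_div]
  simp only [h3]

end Ergodic

/-! ### Existence of an invariant measure -/

section KrylovBogoliubov

open scoped BoundedContinuousFunction

variable {E : Type*} [NormedAddCommGroup E] [ProperSpace E] [MeasurableSpace E] [BorelSpace E]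
  {κ : Kernel E E} [IsMarkovKernel κ]

lemma lintegral_pow_norm_le {ρ M C : ℝ≥0∞} (hC : ρ * C + M ≤ C)
    (drift : ∀ v, ∫⁻ z, ‖z‖ₑ ∂(κ v) ≤ ρ * ‖v‖ₑ + M) (n : ℕ) :
    ∫⁻ z, ‖z‖ₑ ∂((κ ^ n) 0) ≤ C := by
  induction n with
  | zero =>
    rw [pow_zero]
    change ∫⁻ z, ‖z‖ₑ ∂(Kernel.id (0 : E)) ≤ C
    rw [Kernel.id_apply, lintegral_dirac' _ (by fun_prop)]
    simp
  | succ n ih =>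
    have := isMarkovKernel_pow κ n
    rw [pow_succ']
    change ∫⁻ z, ‖z‖ₑ ∂((κ ∘ₖ (κ ^ n)) 0) ≤ C
    rw [Kernel.lintegral_comp _ _ _ (by fun_prop)]
    calc ∫⁻ v, ∫⁻ z, ‖z‖ₑ ∂(κ v) ∂((κ ^ n) 0) ≤ ∫⁻ v, ρ * ‖v‖ₑ + M ∂((κ ^ n) 0) :=
          lintegral_mono drift
      _ = ρ * ∫⁻ v, ‖v‖ₑ ∂((κ ^ n) 0) + M := by
          rw [lintegral_add_right _ measurable_const, lintegral_const_mul _ (by fun_prop)]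
          simp
      _ ≤ ρ * C + M := by gcongr
      _ ≤ C := hC

/-- **Krylov–Bogoliubov**: a Feller kernel on a proper normed group with a first-moment drift
condition has an invariant probability measure. -/
theorem exists_invariant_of_feller {ρ M : ℝ≥0∞} {C : ℝ≥0} (hC : ρ * C + M ≤ C)
    (feller : ∀ f : E →ᵇ ℝ, Continuous fun v => ∫ z, f z ∂(κ v))
    (drift : ∀ v, ∫⁻ z, ‖z‖ₑ ∂(κ v) ≤ ρ * ‖v‖ₑ + M) :
    ∃ μ : Measure E, IsProbabilityMeasure μ ∧ Kernel.Invariant κ μ := by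
  have hmk := isMarkovKernel_pow κ
  let A : ℕ → Measure E := fun n =>
    ((n + 1 : ℕ) : ℝ≥0∞)⁻¹ • ∑ k ∈ Finset.range (n + 1), (κ ^ k) 0
  have hn0 : ∀ n : ℕ, ((n + 1 : ℕ) : ℝ≥0∞) ≠ 0 := fun n => by simp
  have hnt : ∀ n : ℕ, ((n + 1 : ℕ) : ℝ≥0∞) ≠ ∞ := fun n => ENNReal.natCast_ne_top _
  have hA : ∀ n, IsProbabilityMeasure (A n) := fun n => ⟨by
    simp only [A, Measure.smul_apply, Measure.finsetSum_apply, measure_univ, Finset.sum_const,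
      Finset.card_range, smul_eq_mul, nsmul_eq_mul, mul_one]
    exact ENNReal.inv_mul_cancel (hn0 n) (hnt n)⟩
  have hAint : ∀ n, ∫⁻ z, ‖z‖ₑ ∂(A n) ≤ C := fun n => by
    simp only [A, lintegral_smul_measure, lintegral_finsetSum_measure, smul_eq_mul]
    calc ((n + 1 : ℕ) : ℝ≥0∞)⁻¹ * ∑ k ∈ Finset.range (n + 1), ∫⁻ z, ‖z‖ₑ ∂((κ ^ k) 0)
        ≤ ((n + 1 : ℕ) : ℝ≥0∞)⁻¹ * ∑ k ∈ Finset.range (n + 1), (C : ℝ≥0∞) := by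
          gcongr with k _
          exact lintegral_pow_norm_le hC drift k
      _ = C := by
          rw [Finset.sum_const, Finset.card_range, nsmul_eq_mul, ← mul_assoc,
            ENNReal.inv_mul_cancel (hn0 n) (hnt n), one_mul]
  let PA : ℕ → ProbabilityMeasure E := fun n => ⟨A n, hA n⟩
  -- The tail bound given by Markov's inequality outside the ball of radius `n + 1`; it does not
  -- depend on the time average, which is tightness.
  let u : ℕ → ℝ≥0 := fun n => C / (n + 1)
  have hu : Tendsto u atTop (𝓝 0) := by
    have := (tendsto_const_div_atTop_nhds_zero_nat (C : ℝ)).comp (tendsto_add_atTop_nat 1)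
    rw [← NNReal.tendsto_coe]
    refine this.congr fun n => ?_
    simp [u]
  have hcomp := isCompact_setOfPred_probabilityMeasure_mass_eq_compl_isCompact_le hu
    (fun n : ℕ => isCompact_closedBall (0 : E) (n + 1)) (Or.inl inferInstance)
  have hmem : ∀ n, PA n ∈ {μ : ProbabilityMeasure E |
      ∀ n : ℕ, μ (Metric.closedBall (0 : E) (n + 1))ᶜ ≤ u n} := by
    intro n j
    have h1 : ((j : ℝ≥0∞) + 1) * A n (Metric.closedBall (0 : E) (j + 1))ᶜ ≤ C := by
      refine le_trans ?_ ((mul_meas_ge_le_lintegral (by fun_prop) ((j : ℝ≥0∞) + 1)).trans (hAint n))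
      gcongr
      intro x hx
      have hx : ((j + 1 : ℕ) : ℝ) < ‖x‖ := by simpa using hx
      have : ((j + 1 : ℕ) : ℝ≥0∞) ≤ ‖x‖ₑ := by
        rw [← ofReal_norm, ← ENNReal.ofReal_natCast]
        exact ENNReal.ofReal_le_ofReal hx.le
      simpa using this
    rw [← ENNReal.coe_le_coe, ProbabilityMeasure.ennreal_coeFn_eq_coeFn_toMeasure]
    simp only [u]
    rw [ENNReal.coe_div (by positivity)]
    rw [ENNReal.le_div_iff_mul_le (by simp) (by simp), mul_comm]
    simpa [PA] using h1
  -- A nonprincipal ultrafilter selects a limit point of the time averages without extracting a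
  -- subsequence.
  let U : Filter ℕ := hyperfilter ℕ
  have hU : U ≤ atTop := by
    rw [← Nat.cofinite_eq_atTop]; exact hyperfilter_le_cofinite
  obtain ⟨μ, -, hμ⟩ := isCompact_iff_ultrafilter_le_nhds.1 hcomp ((hyperfilter ℕ).map PA)
    
    (le_principal_iff.2 (Ultrafilter.mem_map.2 (Eventually.of_forall hmem)))
  have hμ : Tendsto PA U (𝓝 μ) := hμ
  rw [ProbabilityMeasure.tendsto_iff_forall_integral_tendsto] at hμ
  refine ⟨μ, inferInstance, ?_⟩
  refine ext_of_forall_integral_eq_of_IsFiniteMeasure fun f => ?_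
  have hfi : ∀ (ν : Measure E) [IsProbabilityMeasure ν], Integrable f ν :=
    fun ν _ => f.integrable ν
  have hbound : ∀ (ν : Measure E) [IsProbabilityMeasure ν], |∫ z, f z ∂ν| ≤ ‖f‖ := fun ν _ => by
    rw [← Real.norm_eq_abs]
    exact f.norm_integral_le_norm ν
  let g : E →ᵇ ℝ := BoundedContinuousFunction.ofNormedAddCommGroup (fun v => ∫ z, f z ∂(κ v))
    (feller f) ‖f‖ fun v => f.norm_integral_le_norm _
  have hbind : ∫ z, f z ∂((μ : Measure E).bind κ) = ∫ v, g v ∂μ := integral_bind_kernel (hfi _)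
  rw [hbind]
  have hAsum : ∀ (n : ℕ) (h : E →ᵇ ℝ), ∫ z, h z ∂(A n) =
      ((n + 1 : ℕ) : ℝ)⁻¹ * ∑ k ∈ Finset.range (n + 1), ∫ z, h z ∂((κ ^ k) 0) := fun n h => by
    simp only [A]
    rw [integral_smul_measure, integral_finsetSum_measure fun k _ => h.integrable _]
    rw [ENNReal.toReal_inv, ENNReal.toReal_natCast, smul_eq_mul]
  -- Applying `κ` to a time average shifts the sum by one, so the difference telescopes and is
  -- `O(1/n)`.
  have hdiff : ∀ n, ∫ z, g z ∂(A n) - ∫ z, f z ∂(A n) =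
      ((n + 1 : ℕ) : ℝ)⁻¹ * (∫ z, f z ∂((κ ^ (n + 1)) 0) - ∫ z, f z ∂((κ ^ 0) 0)) := fun n => by
    rw [hAsum, hAsum, ← mul_sub, ← Finset.sum_sub_distrib,
      ← Finset.sum_range_sub (fun k => ∫ z, f z ∂((κ ^ k) 0))]
    congr 1
    refine Finset.sum_congr rfl fun k _ => ?_
    rw [integral_pow_succ (hfi _)]
    rfl
  have hlim0 : Tendsto (fun n => ∫ z, g z ∂(A n) - ∫ z, f z ∂(A n)) atTop (𝓝 0) := by
    have h2 : Tendsto (fun n : ℕ => ((n + 1 : ℕ) : ℝ)⁻¹ * (2 * ‖f‖)) atTop (𝓝 0) := by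
      have := (tendsto_inv_atTop_nhds_zero_nat (𝕜 := ℝ)).comp (tendsto_add_atTop_nat 1)
      simpa using this.mul_const (2 * ‖f‖)
    refine squeeze_zero_norm (fun n => ?_) h2
    rw [hdiff, norm_mul, Real.norm_of_nonneg (by positivity)]
    gcongr
    calc _ ≤ |∫ z, f z ∂((κ ^ (n + 1)) 0)| + |∫ z, f z ∂((κ ^ 0) 0)| := abs_sub _ _
      _ ≤ 2 * ‖f‖ := by linarith [hbound ((κ ^ (n + 1)) 0), hbound ((κ ^ 0) 0)]
  have hlim1 := (hμ g).sub (hμ f)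
  exact sub_eq_zero.1 (tendsto_nhds_unique hlim1 (hlim0.mono_left hU))

end KrylovBogoliubov

/-! ### The implicit Euler map in sine coefficients -/

/-- Coefficient vectors with respect to the first `N` eigenfunctions. -/
abbrev Coeff (N : ℕ) : Type := EuclideanSpace ℂ (Fin N)

/-- The function with the given sine coefficients. -/
noncomputable def sineSum {N : ℕ} (c : Coeff N) (x : ℝ) : ℂ := ∑ m, c m * sineMode m x

/-- The `n`-th eigenvalue of the Dirichlet Laplacian. -/
noncomputable def eigenvalue (n : ℕ) : ℝ := ((n + 1) * Real.pi) ^ 2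

/-- The nonlinearity of the scheme as a function of the new and the (damped) old value. -/
noncomputable def cubic (z v : ℂ) : ℂ := ((‖z‖ ^ 2 + ‖v‖ ^ 2 : ℝ) : ℂ) / 2 * z

/-- The sine coefficients of the projected nonlinearity. -/
noncomputable def cubicCoeff {N : ℕ} (s : ℝ) (b c : Coeff N) (m : Fin N) : ℂ :=
  ∫ x in (0 : ℝ)..1, cubic (sineSum c x) (s * sineSum b x) * conj (sineMode m x)

/-- The implicit part of one Euler step in sine coefficients, with old state `b`. -/
noncomputable def eulerMap {N : ℕ} (s lam τ : ℝ) (b c : Coeff N) : Coeff N :=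
  WithLp.toLp 2 fun m => c m + Complex.I * τ * eigenvalue m * c m
    - Complex.I * τ * lam * cubicCoeff s b c m

/-! ### Sector condition for the cubic term -/

section Basic

variable {N : ℕ}

lemma sineMode_continuous (m : ℕ) : Continuous (sineMode m) := by
  unfold sineMode; fun_prop

lemma conj_sineMode (m : ℕ) (x : ℝ) : conj (sineMode m x) = sineMode m x := by
  simp only [sineMode, Complex.conj_ofReal]

lemma sineSum_continuous (c : Coeff N) : Continuous (sineSum c) := by
  unfold sineSum
  exact continuous_finsetSum _ fun m _ => continuous_const.mul (sineMode_continuous m)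

lemma sineSum_sub (c d : Coeff N) (x : ℝ) : sineSum (c - d) x = sineSum c x - sineSum d x := by
  simp [sineSum, sub_mul, Finset.sum_sub_distrib]

lemma conj_sineSum (c : Coeff N) (x : ℝ) :
    conj (sineSum c x) = ∑ m, conj (c m) * sineMode m x := by
  simp only [sineSum, map_sum, map_mul, conj_sineMode]

lemma cubic_eq (z v : ℂ) : cubic z v = (z * conj z + v * conj v) / 2 * z := by
  simp only [cubic, Complex.mul_conj, Complex.normSq_eq_norm_sq]
  push_cast
  ring

lemma cubic_sineSum_continuous (s : ℝ) (b c : Coeff N) :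
    Continuous fun x => cubic (sineSum c x) (s * sineSum b x) := by
  have := sineSum_continuous b
  have := sineSum_continuous c
  unfold cubic
  fun_prop

/-- With `A = |z|²`, `B = |w|²`, `δ = z - w` and `p = Im(z w̄)`, twice the imaginary part is `-(A -
B) p`, while twice the real part is `((A + B)|δ|² + (A - B)²)/2 + |v|²|δ|²`. As `p` is up to sign
both `Im(z δ̄)` and `Im(w δ̄)`, one has `p² ≤ |δ|² min(A, B)`, and `2|A - B||p| ≤ (A - B)² + p²`
finishes. -/
lemma abs_im_cubic_sub_le (z w v : ℂ) :
    |((cubic z v - cubic w v) * conj (z - w)).im| ≤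
      ((cubic z v - cubic w v) * conj (z - w)).re := by
  obtain ⟨a, b⟩ := z
  obtain ⟨c, d⟩ := w
  have hq : 0 ≤ ‖v‖ ^ 2 := by positivity
  have h1 : ∀ x y : ℝ, ‖(⟨x, y⟩ : ℂ)‖ ^ 2 = x ^ 2 + y ^ 2 := fun x y => by
    rw [← Complex.normSq_eq_norm_sq, Complex.normSq_mk]; ring
  have h2 : ∀ r : ℝ, ((r : ℂ) / 2) = ((r / 2 : ℝ) : ℂ) := fun r => by push_cast; rfl
  simp only [cubic, h1, h2, Complex.mul_re, Complex.mul_im, Complex.sub_re, Complex.sub_im,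
    Complex.conj_re, Complex.conj_im, Complex.ofReal_re, Complex.ofReal_im]
  set q := ‖v‖ ^ 2
  have hP : (b * c - a * d) ^ 2 ≤ ((a - c) ^ 2 + (b - d) ^ 2) * (a ^ 2 + b ^ 2) := by
    nlinarith [sq_nonneg ((b - d) * b + (a - c) * a)]
  have hP' : (b * c - a * d) ^ 2 ≤ ((a - c) ^ 2 + (b - d) ^ 2) * (c ^ 2 + d ^ 2) := by
    nlinarith [sq_nonneg ((b - d) * d + (a - c) * c)]
  have hqd : 0 ≤ q * ((a - c) ^ 2 + (b - d) ^ 2) := by positivity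
  set A := a ^ 2 + b ^ 2 with hA
  set B := c ^ 2 + d ^ 2 with hB
  have h3 := sq_nonneg ((A - B) - (b * c - a * d))
  have h4 := sq_nonneg ((A - B) + (b * c - a * d))
  rw [abs_le]
  constructor
  · have key : 2 * (A - B) * (b * c - a * d) ≤ (A - B) ^ 2 +
      ((a - c) ^ 2 + (b - d) ^ 2) * (A + B) / 2 := by linarith
    rw [hA, hB] at key ⊢
    nlinarith
  · have key : - 2 * (A - B) * (b * c - a * d) ≤ (A - B) ^ 2 +
      ((a - c) ^ 2 + (b - d) ^ 2) * (A + B) / 2 := by linarith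
    rw [hA, hB] at key ⊢
    nlinarith

lemma intervalIntegrable_of_continuous {f : ℝ → ℂ} (hf : Continuous f) :
    IntervalIntegrable f volume 0 1 := hf.intervalIntegrable _ _

/-- Testing against an element of the Galerkin space removes the projection, so pointwise
inequalities can be integrated. -/
lemma sum_integral_mul_conj (g : ℝ → ℂ) (hg : Continuous g) (d : Coeff N) :
    ∑ m : Fin N, (∫ x in (0 : ℝ)..1, g x * conj (sineMode m x)) * conj (d m) =
      ∫ x in (0 : ℝ)..1, g x * conj (sineSum d x) := by
  simp_rw [← intervalIntegral.integral_mul_const]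
  rw [← intervalIntegral.integral_finsetSum]
  · refine intervalIntegral.integral_congr fun x _ => ?_
    simp only [conj_sineSum, conj_sineMode, Finset.mul_sum]
    exact Finset.sum_congr rfl fun m _ => by ring
  · intro m _
    have := sineMode_continuous m
    exact intervalIntegrable_of_continuous (by fun_prop)

lemma abs_im_integral_le_re {g : ℝ → ℂ} (hg : Continuous g) (h : ∀ x, |(g x).im| ≤ (g x).re) :
    |(∫ x in (0 : ℝ)..1, g x).im| ≤ (∫ x in (0 : ℝ)..1, g x).re := by
  have hre : (∫ x in (0 : ℝ)..1, g x).re = ∫ x in (0 : ℝ)..1, (g x).re :=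
    (Complex.reCLM.intervalIntegral_comp_comm (intervalIntegrable_of_continuous hg)).symm
  have him : (∫ x in (0 : ℝ)..1, g x).im = ∫ x in (0 : ℝ)..1, (g x).im :=
    (Complex.imCLM.intervalIntegral_comp_comm (intervalIntegrable_of_continuous hg)).symm
  rw [hre, him]
  refine (intervalIntegral.abs_integral_le_integral_abs zero_le_one).trans ?_
  refine intervalIntegral.integral_mono_on zero_le_one ?_ ?_ fun x _ => h x
  · exact (Complex.continuous_im.comp hg).abs.intervalIntegrable _ _
  · exact (Complex.continuous_re.comp hg).intervalIntegrable _ _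

lemma abs_im_sum_cubicCoeff_le (s : ℝ) (b c d : Coeff N) :
    |(∑ m, (cubicCoeff s b c m - cubicCoeff s b d m) * conj ((c - d) m)).im| ≤
      (∑ m, (cubicCoeff s b c m - cubicCoeff s b d m) * conj ((c - d) m)).re := by
  have hc := cubic_sineSum_continuous s b c
  have hd := cubic_sineSum_continuous s b d
  have hcd := sineSum_continuous (c - d)
  have : ∑ m, (cubicCoeff s b c m - cubicCoeff s b d m) * conj ((c - d) m) =
      ∫ x in (0 : ℝ)..1, (cubic (sineSum c x) (s * sineSum b x) -
        cubic (sineSum d x) (s * sineSum b x)) * conj (sineSum (c - d) x) := by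
    simp_rw [sub_mul _ _ (conj (sineSum (c - d) _)), sub_mul _ _ (conj ((c - d) _))]
    rw [intervalIntegral.integral_sub, Finset.sum_sub_distrib]
    · rw [← sum_integral_mul_conj _ hc, ← sum_integral_mul_conj _ hd]
      rfl
    · exact intervalIntegrable_of_continuous (by fun_prop)
    · exact intervalIntegrable_of_continuous (by fun_prop)
  rw [this]
  refine abs_im_integral_le_re (by fun_prop) fun x => ?_
  rw [sineSum_sub]
  exact abs_im_cubic_sub_le _ _ _

/-- The integrand is a real multiple of `|sineSum c x|²`. -/
lemma im_sum_cubicCoeff_self (s : ℝ) (b c : Coeff N) :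
    (∑ m, cubicCoeff s b c m * conj (c m)).im = 0 := by
  have hc := cubic_sineSum_continuous s b c
  have hcd := sineSum_continuous c
  have : ∑ m, cubicCoeff s b c m * conj (c m) = ∫ x in (0 : ℝ)..1,
      cubic (sineSum c x) (s * sineSum b x) * conj (sineSum c x) := sum_integral_mul_conj _ hc _
  rw [this]
  have him := (Complex.imCLM.intervalIntegral_comp_comm (intervalIntegrable_of_continuous
    (f := fun x => cubic (sineSum c x) (s * sineSum b x) * conj (sineSum c x)) (by fun_prop))).symm
  simp only [Complex.imCLM_apply] at him
  rw [him]
  refine intervalIntegral.integral_zero_ae (Eventually.of_forall fun x _ => ?_)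
  rw [cubic, mul_assoc, Complex.mul_conj, ← Complex.ofReal_ofNat, ← Complex.ofReal_div,
    ← Complex.ofReal_mul, Complex.ofReal_im]

end Basic

/-! ### Stability estimates for the implicit map -/

section Estimates

variable {N : ℕ}

lemma norm_sum_mul_conj_le (f d : Coeff N) : ‖∑ m, f m * conj (d m)‖ ≤ ‖f‖ * ‖d‖ := by
  have : inner ℂ d f = ∑ m, f m * conj (d m) := by
    rw [PiLp.inner_apply]
    rfl
  rw [← this, mul_comm]
  exact norm_inner_le_norm _ _

lemma sum_mul_conj_self (d : Coeff N) : ∑ m, d m * conj (d m) = ((‖d‖ ^ 2 : ℝ) : ℂ) := by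
  rw [EuclideanSpace.norm_sq_eq, Complex.ofReal_sum]
  simp only [Complex.mul_conj, Complex.normSq_eq_norm_sq]

lemma eigenvalue_nonneg (n : ℕ) : 0 ≤ eigenvalue n := by unfold eigenvalue; positivity

lemma eigenvalue_le {m : ℕ} (hm : m < N) : eigenvalue m ≤ (N * Real.pi) ^ 2 := by
  unfold eigenvalue
  have : ((m : ℝ) + 1) ≤ N := by exact_mod_cast hm
  gcongr

/-- The threshold on the time step, as a condition on `τ`. -/
def StepSmall (lam τ : ℝ) (N : ℕ) : Prop := lam = 1 → τ * (N * Real.pi) ^ 2 < 1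

lemma sum_eigenvalue_mul (d : Coeff N) :
    ∑ m : Fin N, (eigenvalue m : ℂ) * (d m * conj (d m)) =
      ((∑ m : Fin N, eigenvalue m * ‖d m‖ ^ 2 : ℝ) : ℂ) := by
  rw [Complex.ofReal_sum]
  simp only [Complex.mul_conj, Complex.normSq_eq_norm_sq, Complex.ofReal_mul]

/-- Let `D = ‖c - d‖²` and let `B` bound the pairing of the difference of values with `c - d`. Its
real part is `D + τ lam Im J`, its imaginary part `τ K - τ lam Re J`, and `|Im J| ≤ Re J`. For `lam
= -1` the terms `τ K` and `τ Re J` add up, so `D ≤ 2B`. For `lam = 1` only `τ Re J ≤ B + τ K`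
remains, and `K` is bounded by the largest eigenvalue times `D`. -/
lemma norm_sq_le_of_eulerMap {s lam τ : ℝ} (hlam : lam = -1 ∨ lam = 0 ∨ lam = 1) (hτ : 0 ≤ τ)
    (b c d : Coeff N) :
    ‖c - d‖ ^ 2 ≤ (if lam = 1 then τ * (N * Real.pi) ^ 2 else 0) * ‖c - d‖ ^ 2
      + 2 * (‖eulerMap s lam τ b c - eulerMap s lam τ b d‖ * ‖c - d‖) := by
  set f := eulerMap s lam τ b c - eulerMap s lam τ b d with hf
  set J := ∑ m, (cubicCoeff s b c m - cubicCoeff s b d m) * conj ((c - d) m) with hJ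
  set K := ∑ m : Fin N, eigenvalue m * ‖(c - d) m‖ ^ 2 with hK
  have hpair : ∑ m, f m * conj ((c - d) m) =
      ((‖c - d‖ ^ 2 : ℝ) : ℂ) + Complex.I * τ * (K : ℂ) - Complex.I * τ * lam * J := by
    rw [← sum_mul_conj_self, hK, ← sum_eigenvalue_mul, hJ, Finset.mul_sum, Finset.mul_sum,
      ← Finset.sum_add_distrib, ← Finset.sum_sub_distrib]
    refine Finset.sum_congr rfl fun m _ => ?_
    simp only [hf, eulerMap, PiLp.sub_apply]
    ring
  have hJle := abs_im_sum_cubicCoeff_le s b c d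
  rw [← hJ] at hJle
  have hnorm := norm_sum_mul_conj_le f (c - d)
  have hre := (Complex.abs_re_le_norm _).trans hnorm
  have him := (Complex.abs_im_le_norm _).trans hnorm
  rw [hpair] at hre him
  have hKn : 0 ≤ K := Finset.sum_nonneg fun m _ =>
    mul_nonneg (eigenvalue_nonneg _) (by positivity)
  have hKle : K ≤ (N * Real.pi) ^ 2 * ‖c - d‖ ^ 2 := by
    rw [EuclideanSpace.norm_sq_eq, Finset.mul_sum]
    exact Finset.sum_le_sum fun m _ => mul_le_mul_of_nonneg_right (eigenvalue_le m.2) (by positivity)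
  simp only [Complex.sub_re, Complex.add_re, Complex.sub_im, Complex.add_im, Complex.mul_re,
    Complex.mul_im, Complex.I_re, Complex.I_im, Complex.ofReal_re, Complex.ofReal_im,
    zero_mul, mul_zero, one_mul, sub_zero, zero_sub, add_zero, zero_add] at hre him
  set B := ‖f‖ * ‖c - d‖
  set D := ‖c - d‖ ^ 2
  rw [abs_le] at hre him hJle
  have t1 := mul_le_mul_of_nonneg_left hJle.2 hτ
  have t2 := mul_le_mul_of_nonneg_left hJle.1 hτ
  have t3 := mul_le_mul_of_nonneg_left hKle hτ
  have t4 := mul_nonneg hτ hKn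
  rcases hlam with h | h | h
  · rw [if_neg (by rw [h]; norm_num)]
    subst h
    linarith
  · rw [if_neg (by rw [h]; norm_num)]
    subst h
    linarith
  · rw [if_pos h]
    subst h
    linarith

/-- The Lipschitz constant of the inverse of the implicit map. -/
noncomputable def stepConst (lam τ : ℝ) (N : ℕ) : ℝ≥0 :=
  Real.toNNReal (2 / (1 - if lam = 1 then τ * (N * Real.pi) ^ 2 else 0))

lemma eulerMap_antilipschitz {s lam τ : ℝ} (hlam : lam = -1 ∨ lam = 0 ∨ lam = 1) (hτ : 0 ≤ τ)
    (hs : StepSmall lam τ N) (b : Coeff N) :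
    AntilipschitzWith (stepConst lam τ N) (eulerMap s lam τ b) := by
  refine AntilipschitzWith.of_le_mul_dist fun c d => ?_
  rw [dist_eq_norm, dist_eq_norm]
  have h := norm_sq_le_of_eulerMap (s := s) hlam hτ b c d
  unfold stepConst
  set θ := if lam = 1 then τ * (N * Real.pi) ^ 2 else 0 with hθ
  have hθ1 : 0 < 1 - θ := by
    rw [hθ]; split_ifs with h1
    · linarith [hs h1]
    · norm_num
  rw [Real.coe_toNNReal _ (by positivity), div_mul_eq_mul_div, le_div_iff₀ hθ1]
  rcases (norm_nonneg (c - d)).eq_or_lt with h0 | h0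
  · rw [← h0]; simp
  · refine le_of_mul_le_mul_right ?_ h0
    nlinarith

/-- Against `c` itself, the Laplacian and the cubic term contribute purely imaginary numbers, so the
real part is exactly `‖c‖²`; no restriction on `τ` is involved. -/
lemma norm_le_norm_eulerMap (s lam τ : ℝ) (b c : Coeff N) : ‖c‖ ≤ ‖eulerMap s lam τ b c‖ := by
  set K := ∑ m : Fin N, eigenvalue m * ‖c m‖ ^ 2 with hK
  have hpair : ∑ m, eulerMap s lam τ b c m * conj (c m) =
      ((‖c‖ ^ 2 : ℝ) : ℂ) + Complex.I * τ * (K : ℂ) -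
        Complex.I * τ * lam * ∑ m, cubicCoeff s b c m * conj (c m) := by
    rw [← sum_mul_conj_self, hK, ← sum_eigenvalue_mul, Finset.mul_sum, Finset.mul_sum,
      ← Finset.sum_add_distrib, ← Finset.sum_sub_distrib]
    refine Finset.sum_congr rfl fun m _ => ?_
    simp only [eulerMap]
    ring
  have hre := (Complex.re_le_norm _).trans (norm_sum_mul_conj_le (eulerMap s lam τ b c) c)
  rw [hpair] at hre
  simp only [Complex.sub_re, Complex.add_re, Complex.mul_re, im_sum_cubicCoeff_self,
    Complex.mul_im, Complex.I_re, Complex.I_im, Complex.ofReal_re, Complex.ofReal_im,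
    zero_mul, mul_zero, one_mul, sub_zero, add_zero, zero_add] at hre
  rcases (norm_nonneg c).eq_or_lt with h0 | h0
  · rw [← h0]; positivity
  · refine le_of_mul_le_mul_right ?_ h0
    nlinarith

end Estimates

/-! ### Smooth antilipschitz maps -/

section Antilipschitz

variable {E : Type*} [NormedAddCommGroup E] [NormedSpace ℝ E]

lemma norm_le_fderiv_of_antilipschitz {f : E → E} {f' : E →L[ℝ] E} {x : E} {K : ℝ≥0}
    (hf : HasFDerivAt f f' x) (h : AntilipschitzWith K f) (v : E) : ‖v‖ ≤ K * ‖f' v‖ := by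
  have h1 : Tendsto (fun t : ℝ => t⁻¹ • (f (x + t • v) - f x)) (𝓝[≠] 0) (𝓝 (f' v)) :=
    (hf.hasLineDerivAt v).tendsto_slope_zero
  refine ge_of_tendsto (h1.norm.const_mul (K : ℝ)) ?_
  filter_upwards [self_mem_nhdsWithin] with t ht
  have h2 := h.le_mul_dist (x + t • v) x
  rw [dist_eq_norm, dist_eq_norm, add_sub_cancel_left, norm_smul] at h2
  have h3 : 0 < ‖t‖ := norm_pos_iff.2 ht
  rw [norm_smul, norm_inv, mul_left_comm, ← div_eq_inv_mul, le_div_iff₀ h3]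
  linarith

lemma injective_fderiv_of_antilipschitz {f : E → E} {f' : E →L[ℝ] E} {x : E} {K : ℝ≥0}
    (hf : HasFDerivAt f f' x) (h : AntilipschitzWith K f) : Function.Injective f' := by
  rw [injective_iff_map_eq_zero]
  intro v hv
  have := norm_le_fderiv_of_antilipschitz hf h v
  rw [hv, norm_zero, mul_zero] at this
  exact norm_le_zero_iff.1 this

variable [FiniteDimensional ℝ E]

/-- A continuously differentiable antilipschitz self-map of a finite-dimensional space is onto. -/
theorem surjective_of_contDiff_of_antilipschitz {f : E → E} {K : ℝ≥0} (hf : ContDiff ℝ 1 f)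
    (h : AntilipschitzWith K f) : Function.Surjective f := by
  -- The derivative is injective, hence onto in finite dimension, so `f` is open; antilipschitz
  -- makes it proper. Its range is then clopen in a connected space.
  have hopen : IsOpenMap f := by
    rw [isOpenMap_iff_nhds_le]
    intro x
    have hx := hf.contDiffAt.hasStrictFDerivAt (x := x) one_ne_zero
    have hinj := injective_fderiv_of_antilipschitz hx.hasFDerivAt h
    exact (hx.map_nhds_eq_of_surj (LinearMap.range_eq_top.2
      (LinearMap.injective_iff_surjective.1 hinj))).ge
  have : ProperSpace E := FiniteDimensional.proper_real E
  have hproper : IsProperMap f := by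
    rw [isProperMap_iff_tendsto_cocompact]
    refine ⟨hf.continuous, ?_⟩
    rw [← Metric.cobounded_eq_cocompact]
    exact h.tendsto_cobounded
  rw [← Set.range_eq_univ]
  exact IsClopen.eq_univ ⟨hproper.isClosedMap.isClosed_range, hopen.isOpen_range⟩
    (Set.range_nonempty f)

variable [MeasurableSpace E] [BorelSpace E]

/-- `C¹` maps send null sets to null sets. Conversely, by the area formula the image has measure `∫
|det f'|` over the set, and the Jacobian never vanishes. -/
lemma addHaar_image_eq_zero_iff_of_antilipschitz (μ : Measure E) [μ.IsAddHaarMeasure] {f : E → E}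
    {K : ℝ≥0} (hf : ContDiff ℝ 1 f) (h : AntilipschitzWith K f) {s : Set E}
    (hs : MeasurableSet s) : μ (f '' s) = 0 ↔ μ s = 0 := by
  have hd : ∀ x, HasFDerivAt f (fderiv ℝ f x) x := fun x =>
    (hf.differentiable one_ne_zero x).hasFDerivAt
  refine ⟨fun h0 => ?_, fun h0 => addHaar_image_eq_zero_of_differentiableOn_of_addHaar_eq_zero μ
    (hf.differentiable one_ne_zero).differentiableOn h0⟩
  rw [← lintegral_abs_det_fderiv_eq_addHaar_image μ hs (fun x _ => (hd x).hasFDerivWithinAt)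
    h.injective.injOn] at h0
  have hdet : ∀ x, (fderiv ℝ f x).det ≠ 0 := fun x => by
    have := (LinearMap.injective_iff_surjective (f := (fderiv ℝ f x : E →ₗ[ℝ] E))).1
      (injective_fderiv_of_antilipschitz (hd x) h)
    exact (LinearEquiv.isUnit_det' (LinearEquiv.ofBijective (fderiv ℝ f x : E →ₗ[ℝ] E)
      ⟨injective_fderiv_of_antilipschitz (hd x) h, this⟩)).ne_zero
  by_contra hne
  refine ((setLIntegral_pos_iff ?_).2 ?_).ne' h0
  · have : Continuous fun x => (fderiv ℝ f x).det :=
      ContinuousLinearMap.continuous_det.comp (hf.continuous_fderiv one_ne_zero)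
    exact (this.measurable.abs).ennreal_ofReal
  · have : (Function.support fun x => ENNReal.ofReal |(fderiv ℝ f x).det|) = Set.univ :=
      Set.eq_univ_of_forall fun x => by simp [hdet x]
    rw [this, Set.univ_inter]
    exact pos_iff_ne_zero.2 hne

end Antilipschitz

/-! ### Solving the implicit equation -/

section Smooth

variable {N : ℕ}

lemma integral_sineSum_mul (c : Coeff N) {h : ℝ → ℂ} (hh : Continuous h) :
    ∫ x in (0 : ℝ)..1, sineSum c x * h x =
      ∑ j, c j * ∫ x in (0 : ℝ)..1, sineMode j x * h x := by
  simp_rw [← intervalIntegral.integral_const_mul]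
  rw [← intervalIntegral.integral_finsetSum]
  · refine intervalIntegral.integral_congr fun x _ => ?_
    simp only [sineSum, Finset.sum_mul, mul_assoc]
  · intro m _
    have := sineMode_continuous m
    exact intervalIntegrable_of_continuous (by fun_prop)

lemma integral_conj_sineSum_mul (c : Coeff N) {h : ℝ → ℂ} (hh : Continuous h) :
    ∫ x in (0 : ℝ)..1, conj (sineSum c x) * h x =
      ∑ j, conj (c j) * ∫ x in (0 : ℝ)..1, sineMode j x * h x := by
  simp_rw [← intervalIntegral.integral_const_mul]
  rw [← intervalIntegral.integral_finsetSum]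
  · refine intervalIntegral.integral_congr fun x _ => ?_
    simp only [conj_sineSum, Finset.sum_mul, mul_assoc]
  · intro m _
    have := sineMode_continuous m
    exact intervalIntegrable_of_continuous (by fun_prop)

/-- Expanding one factor at a time gives a polynomial in the coefficients and their conjugates.
Conjugation is why smoothness is over `ℝ`. -/
lemma contDiff_integral_sineSum_mul {F : Type*} [NormedAddCommGroup F] [NormedSpace ℝ F]
    {a b c : F → Coeff N} (ha : ContDiff ℝ 1 a) (hb : ContDiff ℝ 1 b) (hc : ContDiff ℝ 1 c)
    {h : ℝ → ℂ} (hh : Continuous h) :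
    ContDiff ℝ 1 fun p => ∫ x in (0 : ℝ)..1,
      sineSum (a p) x * (conj (sineSum (b p) x) * (sineSum (c p) x * h x)) := by
  have hj : ∀ j : Fin N, Continuous (sineMode j) := fun j => sineMode_continuous j
  have hac : ∀ c : Coeff N, Continuous (sineSum c) := sineSum_continuous
  have hcoord : ∀ {a : F → Coeff N}, ContDiff ℝ 1 a → ∀ j, ContDiff ℝ 1 fun p => a p j :=
    fun ha j => (contDiff_piLp 2).1 ha j
  have h1 : ∀ {a : F → Coeff N} {g : F → ℝ → ℂ}, ContDiff ℝ 1 a → (∀ p, Continuous (g p)) →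
      (∀ j : Fin N, ContDiff ℝ 1 fun p => ∫ x in (0 : ℝ)..1, sineMode j x * g p x) →
      ContDiff ℝ 1 fun p => ∫ x in (0 : ℝ)..1, sineSum (a p) x * g p x := by
    intro a g ha hg hi
    simp_rw [fun p => integral_sineSum_mul (a p) (hg p)]
    exact ContDiff.sum fun j _ => (hcoord ha j).mul (hi j)
  have h2 : ∀ {a : F → Coeff N} {g : F → ℝ → ℂ}, ContDiff ℝ 1 a → (∀ p, Continuous (g p)) →
      (∀ j : Fin N, ContDiff ℝ 1 fun p => ∫ x in (0 : ℝ)..1, sineMode j x * g p x) →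
      ContDiff ℝ 1 fun p => ∫ x in (0 : ℝ)..1, conj (sineSum (a p) x) * g p x := by
    intro a g ha hg hi
    simp_rw [fun p => integral_conj_sineSum_mul (a p) (hg p)]
    exact ContDiff.sum fun j _ => (Complex.conjCLE.contDiff.comp (hcoord ha j)).mul (hi j)
  refine h1 ha (fun p => by fun_prop) fun j => ?_
  simp_rw [mul_left_comm (sineMode j _)]
  refine h2 hb (fun p => by fun_prop) fun k => ?_
  simp_rw [mul_left_comm (sineMode _ _) (sineSum _ _)]
  refine h1 hc (fun p => by fun_prop) fun l => contDiff_const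

lemma cubicCoeff_eq (s : ℝ) (b c : Coeff N) (m : Fin N) :
    cubicCoeff s b c m =
      (∫ x in (0 : ℝ)..1, sineSum c x * (conj (sineSum c x) * (sineSum c x *
        (conj (sineMode m x) / 2)))) +
      ∫ x in (0 : ℝ)..1, sineSum b x * (conj (sineSum b x) * (sineSum c x *
        ((s : ℂ) ^ 2 * conj (sineMode m x) / 2))) := by
  have hb := sineSum_continuous b
  have hc := sineSum_continuous c
  have hm := sineMode_continuous m
  rw [← intervalIntegral.integral_add]
  · refine intervalIntegral.integral_congr fun x _ => ?_
    simp only [cubic_eq, map_mul, Complex.conj_ofReal]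
    ring
  · exact intervalIntegrable_of_continuous (by fun_prop)
  · exact intervalIntegrable_of_continuous (by fun_prop)

lemma contDiff_cubicCoeff (s : ℝ) (m : Fin N) :
    ContDiff ℝ 1 fun p : Coeff N × Coeff N => cubicCoeff s p.1 p.2 m := by
  have hm := sineMode_continuous m
  simp_rw [cubicCoeff_eq]
  exact (contDiff_integral_sineSum_mul contDiff_snd contDiff_snd contDiff_snd (by fun_prop)).add
    (contDiff_integral_sineSum_mul contDiff_fst contDiff_fst contDiff_snd (by fun_prop))

lemma contDiff_eulerMap (s lam τ : ℝ) :
    ContDiff ℝ 1 fun p : Coeff N × Coeff N => eulerMap s lam τ p.1 p.2 := by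
  refine contDiff_piLp' 2 fun m => ?_
  have h1 : ContDiff ℝ 1 fun p : Coeff N × Coeff N => p.2 m :=
    (contDiff_piLp 2).1 contDiff_snd m
  exact (h1.add (contDiff_const.mul h1)).sub (contDiff_const.mul (contDiff_cubicCoeff s m))

lemma contDiff_eulerMap_right (s lam τ : ℝ) (b : Coeff N) :
    ContDiff ℝ 1 (eulerMap s lam τ b) :=
  (contDiff_eulerMap s lam τ).comp (contDiff_const.prodMk contDiff_id)

lemma eulerMap_bijective {s lam τ : ℝ} (hlam : lam = -1 ∨ lam = 0 ∨ lam = 1) (hτ : 0 ≤ τ)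
    (hs : StepSmall lam τ N) (b : Coeff N) : Function.Bijective (eulerMap s lam τ b) :=
  ⟨(eulerMap_antilipschitz hlam hτ hs b).injective,
    surjective_of_contDiff_of_antilipschitz (contDiff_eulerMap_right s lam τ b)
      (eulerMap_antilipschitz hlam hτ hs b)⟩

/-- The new state as a function of the old state `b` and the right-hand side `y`. -/
noncomputable def eulerSolve (s lam τ : ℝ) (b y : Coeff N) : Coeff N :=
  Function.invFun (eulerMap s lam τ b) y

lemma eulerMap_eulerSolve {s lam τ : ℝ} (hlam : lam = -1 ∨ lam = 0 ∨ lam = 1) (hτ : 0 ≤ τ)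
    (hs : StepSmall lam τ N) (b y : Coeff N) : eulerMap s lam τ b (eulerSolve s lam τ b y) = y :=
  Function.rightInverse_invFun (eulerMap_bijective hlam hτ hs b).2 y

lemma eulerMap_eq_iff {s lam τ : ℝ} (hlam : lam = -1 ∨ lam = 0 ∨ lam = 1) (hτ : 0 ≤ τ)
    (hs : StepSmall lam τ N) {b y c : Coeff N} :
    eulerMap s lam τ b c = y ↔ c = eulerSolve s lam τ b y := by
  refine ⟨fun h => (eulerMap_bijective (s := s) hlam hτ hs b).1 ?_, fun h => ?_⟩
  · rw [h, eulerMap_eulerSolve hlam hτ hs]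
  · rw [h, eulerMap_eulerSolve hlam hτ hs]

lemma norm_eulerSolve_le {s lam τ : ℝ} (hlam : lam = -1 ∨ lam = 0 ∨ lam = 1) (hτ : 0 ≤ τ)
    (hs : StepSmall lam τ N) (b y : Coeff N) : ‖eulerSolve s lam τ b y‖ ≤ ‖y‖ := by
  have := norm_le_norm_eulerMap s lam τ b (eulerSolve s lam τ b y)
  rwa [eulerMap_eulerSolve hlam hτ hs] at this

/-- With `x` the solution at `(b, y)`, the solution at `p` lies within `K * dist p.2 (eulerMap p.1
x)` of `x`. The constant `K` is independent of the old state, which gives joint continuity. -/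
lemma continuous_eulerSolve {s lam τ : ℝ} (hlam : lam = -1 ∨ lam = 0 ∨ lam = 1) (hτ : 0 ≤ τ)
    (hs : StepSmall lam τ N) :
    Continuous fun p : Coeff N × Coeff N => eulerSolve s lam τ p.1 p.2 := by
  rw [continuous_iff_continuousAt]
  rintro ⟨b, y⟩
  rw [ContinuousAt, tendsto_iff_dist_tendsto_zero]
  set x := eulerSolve s lam τ b y with hx
  have hcont : Continuous fun p : Coeff N × Coeff N =>
      (stepConst lam τ N : ℝ) * dist p.2 (eulerMap s lam τ p.1 x) :=
    continuous_const.mul (continuous_snd.dist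
      ((contDiff_eulerMap s lam τ).continuous.comp (continuous_fst.prodMk continuous_const)))
  have h0 := hcont.tendsto (b, y)
  simp only [hx, eulerMap_eulerSolve hlam hτ hs, dist_self, mul_zero] at h0
  refine squeeze_zero (fun _ => dist_nonneg) (fun p => ?_) h0
  have := (eulerMap_antilipschitz (s := s) hlam hτ hs p.1).le_mul_dist
    (eulerSolve s lam τ p.1 p.2) x
  rwa [eulerMap_eulerSolve hlam hτ hs] at this

lemma eulerSolve_preimage {s lam τ : ℝ} (hlam : lam = -1 ∨ lam = 0 ∨ lam = 1) (hτ : 0 ≤ τ)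
    (hs : StepSmall lam τ N) (b : Coeff N) (G : Set (Coeff N)) :
    eulerSolve s lam τ b ⁻¹' G = eulerMap s lam τ b '' G := by
  ext y
  constructor
  · intro h
    exact ⟨_, h, eulerMap_eulerSolve hlam hτ hs b y⟩
  · rintro ⟨c, hc, rfl⟩
    rwa [Set.mem_preimage, ← (eulerMap_eq_iff hlam hτ hs).1 rfl]

lemma addHaar_eulerSolve_preimage_eq_zero_iff {s lam τ : ℝ} (hlam : lam = -1 ∨ lam = 0 ∨ lam = 1) (hτ : 0 ≤ τ)
    (hs : StepSmall lam τ N) (μ : Measure (Coeff N)) [μ.IsAddHaarMeasure]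
    (b : Coeff N) {G : Set (Coeff N)} (hG : MeasurableSet G) :
    μ (eulerSolve s lam τ b ⁻¹' G) = 0 ↔ μ G = 0 := by
  rw [eulerSolve_preimage hlam hτ hs]
  exact addHaar_image_eq_zero_iff_of_antilipschitz μ (contDiff_eulerMap_right s lam τ b)
    (eulerMap_antilipschitz hlam hτ hs b) hG

end Smooth

/-! ### Orthonormality, and sine coefficients as measurable coordinates -/

section Coordinates

lemma integral_cos_int_mul_pi {k : ℤ} (hk : k ≠ 0) :
    ∫ x in (0 : ℝ)..1, Real.cos (k * Real.pi * x) = 0 := by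
  have : (k * Real.pi : ℝ) ≠ 0 := mul_ne_zero (by exact_mod_cast hk) Real.pi_ne_zero
  rw [intervalIntegral.integral_comp_mul_left (fun x => Real.cos x) this, integral_cos]
  simp [Real.sin_int_mul_pi]

lemma integral_sineMode_mul_conj (m n : ℕ) :
    ∫ x in (0 : ℝ)..1, sineMode m x * conj (sineMode n x) = if m = n then 1 else 0 := by
  have h1 : ∀ x : ℝ, sineMode m x * conj (sineMode n x) =
      ((Real.cos (((m - n : ℤ) : ℝ) * Real.pi * x) -
        Real.cos (((m + n + 2 : ℤ) : ℝ) * Real.pi * x) : ℝ) : ℂ) := fun x => by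
    rw [conj_sineMode, sineMode, sineMode, ← Complex.ofReal_mul]
    congr 1
    have h2 : Real.sqrt 2 * Real.sqrt 2 = 2 := Real.mul_self_sqrt (by norm_num)
    have h3 : (((m - n : ℤ) : ℝ) * Real.pi * x) =
      (m + 1) * Real.pi * x - (n + 1) * Real.pi * x := by push_cast; ring
    have h4 : (((m + n + 2 : ℤ) : ℝ) * Real.pi * x) =
      (m + 1) * Real.pi * x + (n + 1) * Real.pi * x := by push_cast; ring
    rw [h3, h4, Real.cos_sub, Real.cos_add]
    linear_combination (Real.sin ((m + 1) * Real.pi * x) * Real.sin ((n + 1) * Real.pi * x)) * h2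
  simp_rw [h1]
  have hc : ∀ k : ℤ, IntervalIntegrable (fun x : ℝ => Real.cos (k * Real.pi * x)) volume 0 1 :=
    fun k => Continuous.intervalIntegrable (by fun_prop) _ _
  rw [intervalIntegral.integral_ofReal, intervalIntegral.integral_sub (hc _) (hc _),
    integral_cos_int_mul_pi (k := m + n + 2) (by positivity), sub_zero]
  split_ifs with h
  · subst h
    simp
  · rw [integral_cos_int_mul_pi (sub_ne_zero.2 (by exact_mod_cast h)), Complex.ofReal_zero]

variable {N : ℕ}

lemma integral_sineSum_mul_conj_sineMode (c : Coeff N) (m : Fin N) :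
    ∫ x in (0 : ℝ)..1, sineSum c x * conj (sineMode m x) = c m := by
  have := sineMode_continuous m
  rw [integral_sineSum_mul c (by fun_prop)]
  simp_rw [integral_sineMode_mul_conj]
  simp [Fin.val_inj]

lemma eq_of_sineSum_eqOn {c d : Coeff N}
    (h : ∀ x ∈ Set.Icc (0 : ℝ) 1, sineSum c x = sineSum d x) : c = d := by
  ext m
  rw [← integral_sineSum_mul_conj_sineMode, ← integral_sineSum_mul_conj_sineMode]
  refine intervalIntegral.integral_congr fun x hx => ?_
  rw [Set.uIcc_of_le zero_le_one] at hx
  simp only [h x hx]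

/-- The element of `V_N` with given sine coefficients. -/
noncomputable def ofCoeff (c : Coeff N) : galerkinSpace N := ∑ m, c m • modeVec N m

lemma coe_ofCoeff (c : Coeff N) : (ofCoeff c : ℝ → ℂ) = sineSum c := by
  funext x
  simp [ofCoeff, sineSum, modeVec, Finset.sum_apply]

lemma coe_galerkinProj (f : ℝ → ℂ) : galerkinProj N f =
    ofCoeff (WithLp.toLp 2 fun m => ∫ x in (0 : ℝ)..1, f x * conj (sineMode m x)) := rfl

lemma ofCoeff_injective : Function.Injective (ofCoeff (N := N)) := by
  intro c d h
  refine eq_of_sineSum_eqOn fun x _ => ?_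
  rw [← coe_ofCoeff, ← coe_ofCoeff, h]

lemma ofCoeff_surjective : Function.Surjective (ofCoeff (N := N)) := by
  rintro ⟨u, hu⟩
  obtain ⟨c, hc⟩ := (Submodule.mem_span_range_iff_exists_fun ℂ).1 hu
  refine ⟨WithLp.toLp 2 c, Subtype.ext ?_⟩
  refine Eq.trans ?_ hc
  simp [ofCoeff, modeVec]

/-- Sine coefficients as linear coordinates on `V_N`. -/
noncomputable def coeffLinearEquiv (N : ℕ) : Coeff N ≃ₗ[ℂ] galerkinSpace N :=
  LinearEquiv.ofBijective
    { toFun := ofCoeff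
      map_add' := fun c d => by simp [ofCoeff, add_smul, Finset.sum_add_distrib]
      map_smul' := fun a c => by simp [ofCoeff, mul_smul, Finset.smul_sum] }
    ⟨ofCoeff_injective, ofCoeff_surjective⟩

lemma measurable_ofCoeff : Measurable (ofCoeff (N := N)) := by
  refine Measurable.subtype_mk (f := fun c : Coeff N => ((ofCoeff c : galerkinSpace N) : ℝ → ℂ))
    (h := fun c => (ofCoeff c).2) ?_
  refine measurable_pi_lambda _ fun x => ?_
  simp_rw [coe_ofCoeff, sineSum]
  fun_prop

/-- Point evaluations span the dual, since only zero is annihilated by all of them; and they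
generate the σ-algebra. This makes the coefficient functionals measurable. -/
lemma measurable_linearFunctional (f : Module.Dual ℂ (galerkinSpace N)) : Measurable f := by
  have : FiniteDimensional ℂ (galerkinSpace N) := (coeffLinearEquiv N).finiteDimensional
  let ev : ℝ → Module.Dual ℂ (galerkinSpace N) := fun x =>
    (LinearMap.proj x).comp (galerkinSpace N).subtype
  have htop : Submodule.span ℂ (Set.range ev) = ⊤ := by
    have h0 : (Submodule.span ℂ (Set.range ev)).dualCoannihilator = ⊥ := by
      rw [eq_bot_iff]
      intro u hu
      rw [Submodule.mem_dualCoannihilator] at hu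
      rw [Submodule.mem_bot]
      ext x
      exact hu (ev x) (Submodule.subset_span ⟨x, rfl⟩)
    rw [← Subspace.dualCoannihilator_dualAnnihilator_eq (W := Submodule.span ℂ (Set.range ev)), h0]
    simp
  have hf : f ∈ Submodule.span ℂ (Set.range ev) := htop ▸ Submodule.mem_top
  induction hf using Submodule.span_induction with
  | mem g hg =>
    obtain ⟨x, rfl⟩ := hg
    exact (measurable_pi_apply x).comp measurable_subtype_coe
  | zero => exact measurable_const
  | add g h _ _ hg hh => exact hg.add hh
  | smul a g _ hg => exact hg.const_mul a

/-- Sine coefficients as measurable coordinates on `V_N`. -/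
noncomputable def coeffEquiv (N : ℕ) : Coeff N ≃ᵐ galerkinSpace N where
  toEquiv := (coeffLinearEquiv N).toEquiv
  measurable_toFun := measurable_ofCoeff
  measurable_invFun := by
    refine (MeasurableEquiv.toLp 2 (Fin N → ℂ)).measurable.comp
      (measurable_pi_lambda (fun u m => (coeffLinearEquiv N).symm u m) fun m => ?_)
    exact measurable_linearFunctional
      ((EuclideanSpace.proj m : Coeff N →L[ℂ] ℂ).toLinearMap.comp
        (coeffLinearEquiv N).symm.toLinearMap)

lemma hasDerivAt_sineMode (m : ℕ) (x : ℝ) : HasDerivAt (sineMode m)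
    ((Real.sqrt 2 * (Real.cos ((m + 1) * Real.pi * x) * ((m + 1) * Real.pi)) : ℝ) : ℂ) x := by
  have h : HasDerivAt (fun x : ℝ => (m + 1) * Real.pi * x) ((m + 1) * Real.pi) x := by
    simpa using (hasDerivAt_id x).const_mul ((m + 1) * Real.pi)
  exact (h.sin.const_mul (Real.sqrt 2)).ofReal_comp

lemma hasDerivAt_deriv_sineMode (m : ℕ) (x : ℝ) : HasDerivAt (fun x : ℝ =>
    ((Real.sqrt 2 * (Real.cos ((m + 1) * Real.pi * x) * ((m + 1) * Real.pi)) : ℝ) : ℂ))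
    (-eigenvalue m * sineMode m x) x := by
  have h : HasDerivAt (fun x : ℝ => (m + 1) * Real.pi * x) ((m + 1) * Real.pi) x := by
    simpa using (hasDerivAt_id x).const_mul ((m + 1) * Real.pi)
  refine ((h.cos.mul_const ((m + 1) * Real.pi)).const_mul (Real.sqrt 2)).ofReal_comp.congr_deriv ?_
  simp only [eigenvalue, sineMode]
  push_cast
  ring

lemma iteratedDeriv_sineSum (c : Coeff N) (x : ℝ) : iteratedDeriv 2 (sineSum c) x =
    sineSum (WithLp.toLp 2 fun m : Fin N => -eigenvalue m * c m) x := by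
  have h1 : deriv (sineSum c) = fun x => ∑ m : Fin N, c m * ((Real.sqrt 2 *
      (Real.cos ((m + 1) * Real.pi * x) * ((m + 1) * Real.pi)) : ℝ) : ℂ) := by
    funext x
    exact (HasDerivAt.fun_sum fun (m : Fin N) _ => (hasDerivAt_sineMode m x).const_mul (c m)).deriv
  rw [iteratedDeriv_succ, iteratedDeriv_one, h1,
    (HasDerivAt.fun_sum fun (m : Fin N) _ => (hasDerivAt_deriv_sineMode m x).const_mul (c m)).deriv]
  simp only [sineSum]
  exact Finset.sum_congr rfl fun m _ => by ring

/-- The residual of the equation at `x` is the sine sum of the coefficient residual, and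
orthonormality on `[0, 1]` makes a vanishing sum have vanishing coefficients. -/
lemma isEulerStep_ofCoeff_iff (α lam : ℝ) (τ : ℝ≥0) (b d c : Coeff N) :
    IsEulerStep α lam τ N (ofCoeff b) (ofCoeff d) (ofCoeff c) ↔
      eulerMap (Real.exp (-α * τ)) lam τ b c = Real.exp (-α * τ) • b + d := by
  set s := Real.exp (-α * τ) with hs
  have hproj : (galerkinProj N fun y => ((‖sineSum c y‖ ^ 2 +
      ‖(s : ℂ) * sineSum b y‖ ^ 2 : ℝ) : ℂ) / 2 * sineSum c y) =
      ofCoeff (WithLp.toLp 2 fun m => cubicCoeff s b c m) := by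
    rw [coe_galerkinProj]
    rfl
  have hdiff : ∀ x, sineSum (eulerMap s lam τ b c - (s • b + d)) x =
      (sineSum c x - s * sineSum b x) -
      ((Complex.I * sineSum (WithLp.toLp 2 fun m : Fin N => -eigenvalue m * c m) x +
        Complex.I * lam * sineSum (WithLp.toLp 2 fun m => cubicCoeff s b c m) x) *
          ((τ : ℝ) : ℂ) + sineSum d x) := fun x => by
    simp only [sineSum, eulerMap, Finset.mul_sum, ← Finset.sum_sub_distrib,
      ← Finset.sum_add_distrib, Finset.sum_mul]
    refine Finset.sum_congr rfl fun m _ => ?_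
    simp only [PiLp.sub_apply, PiLp.add_apply, PiLp.smul_apply, Complex.real_smul]
    ring
  unfold IsEulerStep
  simp only [coe_ofCoeff, hproj, iteratedDeriv_sineSum, ← hs]
  constructor
  · intro h
    rw [← sub_eq_zero]
    refine eq_of_sineSum_eqOn fun x hx => ?_
    rw [hdiff, h x hx, sub_self]
    simp [sineSum]
  · intro h x _
    have := hdiff x
    rw [h, sub_self] at this
    rw [← sub_eq_zero, ← this]
    simp [sineSum]

/-- The solution of one Euler step in `V_N`. -/
@[irreducible]
noncomputable def eulerStep (α lam : ℝ) (τ : ℝ≥0) (N : ℕ) (v w : galerkinSpace N) :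
    galerkinSpace N :=
  coeffEquiv N (eulerSolve (Real.exp (-α * τ)) lam τ ((coeffEquiv N).symm v)
    (Real.exp (-α * τ) • (coeffEquiv N).symm v + (coeffEquiv N).symm w))

lemma isEulerStep_iff {α lam : ℝ} {τ : ℝ≥0} (hlam : lam = -1 ∨ lam = 0 ∨ lam = 1)
    (hs : StepSmall lam τ N) (v w u : galerkinSpace N) :
    IsEulerStep α lam τ N v w u ↔ u = eulerStep α lam τ N v w := by
  obtain ⟨b, rfl⟩ := (coeffEquiv N).surjective v
  obtain ⟨d, rfl⟩ := (coeffEquiv N).surjective w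
  obtain ⟨c, rfl⟩ := (coeffEquiv N).surjective u
  rw [eulerStep, (coeffEquiv N).injective.eq_iff, MeasurableEquiv.symm_apply_apply,
    MeasurableEquiv.symm_apply_apply]
  exact (isEulerStep_ofCoeff_iff α lam τ b d c).trans (eulerMap_eq_iff hlam τ.coe_nonneg hs)

lemma measurable_eulerStep {α lam : ℝ} {τ : ℝ≥0} (hlam : lam = -1 ∨ lam = 0 ∨ lam = 1)
    (hs : StepSmall lam τ N) :
    Measurable fun p : galerkinSpace N × galerkinSpace N => eulerStep α lam τ N p.1 p.2 := by
  have h1 : Measurable fun p : galerkinSpace N × galerkinSpace N => (coeffEquiv N).symm p.1 :=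
    (coeffEquiv N).symm.measurable.comp measurable_fst
  have h2 : Measurable fun p : galerkinSpace N × galerkinSpace N => (coeffEquiv N).symm p.2 :=
    (coeffEquiv N).symm.measurable.comp measurable_snd
  have h0 : Continuous fun q : Coeff N × Coeff N => (q.1, Real.exp (-α * τ) • q.1 + q.2) := by
    fun_prop
  have h3 : Measurable fun q : Coeff N × Coeff N =>
      eulerSolve (Real.exp (-α * τ)) lam τ q.1 (Real.exp (-α * τ) • q.1 + q.2) :=
    ((continuous_eulerSolve hlam τ.coe_nonneg hs).comp h0).measurable
  have h4 := h3.comp (h1.prodMk h2)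
  simp only [eulerStep]
  exact (coeffEquiv N).measurable.comp h4

end Coordinates

/-! ### Complex Gaussian increments and product measures -/

section ProductLaws

lemma pi_absolutelyContinuous {X : Type*} [MeasurableSpace X] {n : ℕ} {μ ν : Fin n → Measure X}
    [∀ i, SigmaFinite (μ i)] [∀ i, SigmaFinite (ν i)] (h : ∀ i, μ i ≪ ν i) :
    Measure.pi μ ≪ Measure.pi ν := by
  induction n with
  | zero => rw [Measure.pi_of_empty, Measure.pi_of_empty]
  | succ n ih =>
    rw [← (measurePreserving_piFinSuccAbove μ 0).symm.map_eq,
      ← (measurePreserving_piFinSuccAbove ν 0).symm.map_eq]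
    exact ((h 0).prod (ih fun j => h _)).map (MeasurableEquiv.measurable _)

instance (τ : ℝ≥0) : IsProbabilityMeasure (complexIncrementLaw τ) :=
  Measure.isProbabilityMeasure_map (MeasurableEquiv.measurable _).aemeasurable

lemma map_volume_equivRealProd_symm :
    (volume : Measure (ℝ × ℝ)).map Complex.measurableEquivRealProd.symm = volume :=
  Complex.volume_preserving_equiv_real_prod.symm.map_eq

lemma complexIncrementLaw_absolutelyContinuous {τ : ℝ≥0} (hτ : τ ≠ 0) :
    complexIncrementLaw τ ≪ volume := by
  rw [← map_volume_equivRealProd_symm]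
  exact ((gaussianReal_absolutelyContinuous 0 hτ).prod
    (gaussianReal_absolutelyContinuous 0 hτ)).map (MeasurableEquiv.measurable _)

lemma absolutelyContinuous_complexIncrementLaw {τ : ℝ≥0} (hτ : τ ≠ 0) :
    volume ≪ complexIncrementLaw τ := by
  rw [← map_volume_equivRealProd_symm]
  exact ((gaussianReal_absolutelyContinuous' 0 hτ).prod
    (gaussianReal_absolutelyContinuous' 0 hτ)).map (MeasurableEquiv.measurable _)

lemma integrable_id_complexIncrementLaw (τ : ℝ≥0) :
    Integrable (fun z : ℂ => z) (complexIncrementLaw τ) := by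
  have hid : Integrable (fun x : ℝ => (x : ℂ)) (gaussianReal 0 τ) :=
    ((memLp_id_gaussianReal' 1 ENNReal.one_ne_top).integrable le_rfl).ofReal
  rw [complexIncrementLaw, integrable_map_equiv]
  have h := (hid.comp_fst (gaussianReal 0 τ)).add
    ((hid.comp_snd (gaussianReal 0 τ)).mul_const Complex.I)
  refine h.congr (Eventually.of_forall fun p => ?_)
  exact Complex.re_add_im (Complex.measurableEquivRealProd.symm p)

lemma map_pi_gaussianReal_bool (τ : ℝ≥0) :
    (Measure.pi fun _ : Bool => gaussianReal 0 τ).map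
      (fun f => (⟨f true, f false⟩ : ℂ)) = complexIncrementLaw τ := by
  have h1 : (fun f : Bool → ℝ => (⟨f true, f false⟩ : ℂ)) =
    Complex.measurableEquivRealProd.symm ∘ fun f => (f true, f false) := rfl
  have h2 : Measurable fun f : Bool → ℝ => (f true, f false) := by fun_prop
  rw [h1, ← Measure.map_map (MeasurableEquiv.measurable _) h2, complexIncrementLaw]
  congr 1
  refine (Measure.prod_eq fun s t hs ht => ?_).symm
  rw [Measure.map_apply h2 (hs.prod ht)]
  have h3 : (fun f : Bool → ℝ => (f true, f false)) ⁻¹' (s ×ˢ t) =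
      Set.univ.pi fun b => if b then s else t := by
    ext f
    simp [and_comm]
  rw [h3, Measure.pi_pi]
  simp

end ProductLaws

/-! ### Law of the noise in coefficients -/

section Noise

variable {N : ℕ}

/-- The coefficients `√ηₘ gₘ` of the noise, as a map of the coefficients `gₘ`. -/
noncomputable def coeffScale (η : ℕ → ℝ) (N : ℕ) (g : Fin N → ℂ) : Coeff N :=
  WithLp.toLp 2 fun m : Fin N => (Real.sqrt (η m) : ℂ) * g m

/-- The law of the noise increment in sine coefficients. -/
noncomputable def coeffNoiseLaw (η : ℕ → ℝ) (τ : ℝ≥0) (N : ℕ) : Measure (Coeff N) :=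
  (Measure.pi fun _ : Fin N => complexIncrementLaw τ).map (coeffScale η N)

lemma continuous_coeffScale (η : ℕ → ℝ) : Continuous (coeffScale η N) := by
  unfold coeffScale
  fun_prop

instance (η : ℕ → ℝ) (τ : ℝ≥0) : IsProbabilityMeasure (coeffNoiseLaw η τ N) :=
  Measure.isProbabilityMeasure_map (continuous_coeffScale η).measurable.aemeasurable

lemma galerkinNoise_eq_comp (η : ℕ → ℝ) :
    galerkinNoise η N = coeffEquiv N ∘ coeffScale η N := rfl

lemma measurable_galerkinNoise (η : ℕ → ℝ) : Measurable (galerkinNoise η N) :=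
  (coeffEquiv N).measurable.comp (continuous_coeffScale η).measurable

lemma map_coeffNoiseLaw (η : ℕ → ℝ) (τ : ℝ≥0) :
    (coeffNoiseLaw η τ N).map (coeffEquiv N) = noiseLaw η τ N := by
  rw [coeffNoiseLaw, Measure.map_map (coeffEquiv N).measurable
    (continuous_coeffScale η).measurable, noiseLaw, galerkinNoise_eq_comp]

instance (η : ℕ → ℝ) (τ : ℝ≥0) : IsProbabilityMeasure (noiseLaw η τ N) :=
  Measure.isProbabilityMeasure_map (measurable_galerkinNoise η).aemeasurable

/-- The invertible scaling of the coefficients when all noise intensities are positive. -/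
noncomputable def coeffScaleEquiv {η : ℕ → ℝ} (hη : ∀ m < N, 0 < η m) :
    (Fin N → ℂ) ≃L[ℂ] Coeff N :=
  LinearEquiv.toContinuousLinearEquiv
    { toFun := coeffScale η N
      map_add' := fun g h => by ext m; simp [coeffScale, mul_add]
      map_smul' := fun a g => by ext m; simp [coeffScale]; ring
      invFun := fun c m => (Real.sqrt (η m) : ℂ)⁻¹ * c m
      left_inv := fun g => by
        funext m
        have : (Real.sqrt (η m) : ℂ) ≠ 0 :=
          Complex.ofReal_ne_zero.2 (Real.sqrt_ne_zero'.2 (hη m m.2))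
        simp only [coeffScale]
        field_simp
      right_inv := fun c => by
        ext m
        have : (Real.sqrt (η m) : ℂ) ≠ 0 :=
          Complex.ofReal_ne_zero.2 (Real.sqrt_ne_zero'.2 (hη m m.2))
        simp only [coeffScale]
        field_simp }

/-- A Lebesgue measure on the coefficient space adapted to the noise. -/
noncomputable def coeffVolume (η : ℕ → ℝ) (N : ℕ) : Measure (Coeff N) :=
  (volume : Measure (Fin N → ℂ)).map (coeffScale η N)

lemma isAddHaarMeasure_coeffVolume {η : ℕ → ℝ} (hη : ∀ m < N, 0 < η m) :
    (coeffVolume η N).IsAddHaarMeasure :=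
  (coeffScaleEquiv hη).isAddHaarMeasure_map volume

lemma coeffNoiseLaw_absolutelyContinuous (η : ℕ → ℝ) {τ : ℝ≥0} (hτ : τ ≠ 0) :
    coeffNoiseLaw η τ N ≪ coeffVolume η N :=
  (pi_absolutelyContinuous fun _ => complexIncrementLaw_absolutelyContinuous hτ).map
    (continuous_coeffScale η).measurable

lemma absolutelyContinuous_coeffNoiseLaw (η : ℕ → ℝ) {τ : ℝ≥0} (hτ : τ ≠ 0) :
    coeffVolume η N ≪ coeffNoiseLaw η τ N :=
  (pi_absolutelyContinuous fun _ => absolutelyContinuous_complexIncrementLaw hτ).map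
    (continuous_coeffScale η).measurable

lemma lintegral_enorm_coeffNoiseLaw_lt_top (η : ℕ → ℝ) (τ : ℝ≥0) :
    ∫⁻ w, ‖w‖ₑ ∂(coeffNoiseLaw η τ N) < ∞ := by
  have hm : Measurable fun w : Coeff N => ‖w‖ₑ := by fun_prop
  rw [coeffNoiseLaw, lintegral_map hm (continuous_coeffScale η).measurable]
  have hcoord : ∀ m : Fin N, Integrable (fun g : Fin N → ℂ => g m)
      (Measure.pi fun _ => complexIncrementLaw τ) := fun m =>
    (measurePreserving_eval (fun _ : Fin N => complexIncrementLaw τ) m).integrable_comp_of_integrable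
      (integrable_id_complexIncrementLaw τ)
  have hle : ∀ g : Fin N → ℂ, ‖coeffScale η N g‖ ≤ ∑ m : Fin N, ‖(Real.sqrt (η m) : ℂ) * g m‖ := fun g => by
    have h1 : coeffScale η N g = ∑ m : Fin N, EuclideanSpace.single m ((Real.sqrt (η m) : ℂ) * g m) := by
      ext j
      simp [coeffScale, Pi.single_apply]
    rw [h1]
    refine (norm_sum_le _ _).trans (Finset.sum_le_sum fun m _ => ?_)
    rw [PiLp.norm_single]
  have hint : Integrable (fun g : Fin N → ℂ => ∑ m : Fin N, ‖(Real.sqrt (η m) : ℂ) * g m‖)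
      (Measure.pi fun _ => complexIncrementLaw τ) :=
    integrable_finsetSum _ fun m _ => ((hcoord m).const_mul _).norm
  have : Integrable (coeffScale η N) (Measure.pi fun _ => complexIncrementLaw τ) :=
    hint.mono' (continuous_coeffScale η).aestronglyMeasurable (Eventually.of_forall hle)
  exact this.2

end Noise

/-! ### Kernels of random maps and the Markov property -/

section RandomMaps

variable {V W : Type*} [MeasurableSpace V] [MeasurableSpace W]

/-- The transition kernel of the random dynamical system `v ↦ F (v, w)`, with `w` of law `ν`. -/
noncomputable def randomMapKernel (F : V × W → V) (ν : Measure W) : Kernel V V :=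
  (Kernel.id ×ₖ Kernel.const V ν).map F

variable {F : V × W → V} {ν : Measure W}

lemma randomMapKernel_apply [SFinite ν] (hF : Measurable F) (v : V) :
    randomMapKernel F ν v = ν.map fun w => F (v, w) := by
  rw [randomMapKernel, Kernel.map_apply _ hF, Kernel.prod_apply, Kernel.id_apply,
    Kernel.const_apply, Measure.dirac_prod, Measure.map_map hF measurable_prodMk_left]
  rfl

lemma isMarkovKernel_randomMapKernel [IsProbabilityMeasure ν] (hF : Measurable F) :
    IsMarkovKernel (randomMapKernel F ν) :=
  Kernel.IsMarkovKernel.map _ hF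

lemma randomMapKernel_apply' [SFinite ν] (hF : Measurable F) (v : V) {G : Set V}
    (hG : MeasurableSet G) : randomMapKernel F ν v G = ν {w | F (v, w) ∈ G} := by
  rw [randomMapKernel_apply hF, Measure.map_apply (by fun_prop) hG]
  rfl

/-- Restricting to an event `A` of the past leaves the noise independent of `X`, with unchanged law.
Letting `A` vary yields the conditional expectation given `m`. -/
lemma map_restrict_prodMk_of_indep {Ω : Type*} {m mΩ : MeasurableSpace Ω} {P : Measure Ω}
    [IsProbabilityMeasure P] (hm : m ≤ mΩ) {X : Ω → V} {Z : Ω → W} (hX : Measurable[m] X)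
    (hZ : Measurable Z) (hind : Indep (MeasurableSpace.comap Z inferInstance) m P)
    {A : Set Ω} (hA : MeasurableSet[m] A) :
    (P.restrict A).map (fun ω => (X ω, Z ω)) = ((P.restrict A).map X).prod (P.map Z) := by
  have hX' : Measurable X := hX.mono hm le_rfl
  have := Measure.isProbabilityMeasure_map (μ := P) hZ.aemeasurable
  refine (Measure.prod_eq fun s t hs ht => ?_).symm
  rw [Measure.map_apply (hX'.prodMk hZ) (hs.prod ht), Measure.map_apply hX' hs,
    Measure.map_apply hZ ht, Measure.restrict_apply ((hX'.prodMk hZ) (hs.prod ht)),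
    Measure.restrict_apply (hX' hs)]
  have h := (Indep_iff _ _ _).1 hind (Z ⁻¹' t) (X ⁻¹' s ∩ A) ⟨t, ht, rfl⟩ ((hX hs).inter hA)
  rw [mul_comm, ← h]
  congr 1
  ext ω
  simp only [Set.mem_inter_iff, Set.mem_preimage, Set.mem_prod]
  tauto

/-- A random map driven by noise independent of the past has the Markov property. -/
theorem condExp_randomMap {Ω : Type*} {m mΩ : MeasurableSpace Ω} {P : Measure Ω}
    [IsProbabilityMeasure P] (hm : m ≤ mΩ) {X Y : Ω → V} {Z : Ω → W} (hX : Measurable[m] X)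
    (hY : Measurable Y) (hZ : Measurable Z)
    (hind : Indep (MeasurableSpace.comap Z inferInstance) m P) (hlaw : P.map Z = ν)
    (hF : Measurable F) (hYF : ∀ᵐ ω ∂P, Y ω = F (X ω, Z ω)) {G : Set V} (hG : MeasurableSet G) :
    P⟦Y ⁻¹' G | m⟧ =ᵐ[P] fun ω => (randomMapKernel F ν (X ω)).real G := by
  have hX' : Measurable X := hX.mono hm le_rfl
  have : IsProbabilityMeasure ν := hlaw ▸ Measure.isProbabilityMeasure_map hZ.aemeasurable
  have := isMarkovKernel_randomMapKernel (ν := ν) hF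
  have hκm : Measurable[m] fun ω => randomMapKernel F ν (X ω) G :=
    ((randomMapKernel F ν).measurable_coe hG).comp hX
  have hκ : Measurable[m] fun ω => (randomMapKernel F ν (X ω)).real G := hκm.ennreal_toReal
  have hint : Integrable (fun ω => (randomMapKernel F ν (X ω)).real G) P := by
    refine Integrable.of_bound (hκ.mono hm le_rfl).aestronglyMeasurable 1
      (Eventually.of_forall fun ω => ?_)
    rw [Real.norm_of_nonneg measureReal_nonneg]
    exact measureReal_le_one
  symm
  refine ae_eq_condExp_of_forall_setIntegral_eq hm
    ((integrable_const 1).indicator (hY hG)) (fun _ _ _ => hint.integrableOn) (fun A hA _ => ?_)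
    (hκ.stronglyMeasurable.aestronglyMeasurable)
  have hlhs : ∫ ω in A, (randomMapKernel F ν (X ω)).real G ∂P =
      (∫⁻ ω in A, randomMapKernel F ν (X ω) G ∂P).toReal :=
    integral_toReal (hκm.mono hm le_rfl).aemeasurable
      (Eventually.of_forall fun ω => measure_lt_top _ _)
  have hrhs : ∫ ω in A, (Y ⁻¹' G).indicator (fun _ => (1 : ℝ)) ω ∂P =
      (P.restrict A).real (Y ⁻¹' G) :=
    integral_indicator_one (hY hG)
  rw [hlhs, hrhs, measureReal_def]
  congr 1
  have hYae : (P.restrict A) (Y ⁻¹' G) = (P.restrict A) ((fun ω => (X ω, Z ω)) ⁻¹' (F ⁻¹' G)) := by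
    refine measure_congr ?_
    filter_upwards [ae_restrict_of_ae hYF] with ω hω
    simp only [eq_iff_iff]
    change Y ω ∈ G ↔ F (X ω, Z ω) ∈ G
    rw [hω]
  rw [hYae, ← Measure.map_apply (hX'.prodMk hZ) (hF hG),
    map_restrict_prodMk_of_indep hm hX hZ hind hA, hlaw, Measure.prod_apply (hF hG),
    lintegral_map (measurable_measure_prodMk_left (hF hG)) hX']
  refine lintegral_congr fun ω => ?_
  rw [randomMapKernel_apply' hF _ hG]
  rfl

lemma invariant_map {E : Type*} [MeasurableSpace E] {κ : Kernel E E} {κ' : Kernel V V}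
    (e : E ≃ᵐ V) (h : ∀ b, κ' (e b) = (κ b).map e) {μ : Measure E} (hμ : Kernel.Invariant κ μ) :
    Kernel.Invariant κ' (μ.map e) := by
  refine Measure.ext fun G hG => ?_
  rw [Measure.bind_apply hG κ'.measurable.aemeasurable,
    lintegral_map (κ'.measurable_coe hG) e.measurable, Measure.map_apply e.measurable hG]
  nth_rewrite 2 [← hμ.def]
  rw [Measure.bind_apply (e.measurable hG) κ.measurable.aemeasurable]
  refine lintegral_congr fun b => ?_
  rw [h, Measure.map_apply e.measurable hG]

end RandomMaps

/-! ### Law of the Wiener increments -/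

section Wiener

variable {Ω : Type*} [mΩ : MeasurableSpace Ω] {P : Measure Ω}
  {ℱ : Filtration ℝ≥0 mΩ} {β : ℕ → ℝ≥0 → Ω → ℂ}

lemma measurable_realComponent (hβ : IsWienerFamily P ℱ β) (p : ℕ × Bool) (t : ℝ≥0) :
    Measurable (realComponent β p t) := by
  have h := (hβ.adapted p.1 t).mono (ℱ.le t) le_rfl
  unfold realComponent
  split_ifs
  · exact Complex.measurable_re.comp h
  · exact Complex.measurable_im.comp h

lemma map_wienerIncrement (hβ : IsWienerFamily P ℱ β) (N : ℕ) (s τ : ℝ≥0) :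
    P.map (fun ω (m : Fin N) => β m (s + τ) ω - β m s ω) =
      Measure.pi fun _ => complexIncrementLaw τ := by
  -- The `2N` real increments are independent Gaussians; currying `Fin N × Bool` then regroups their
  -- product law into complex coordinates.
  let D : Fin N × Bool → Ω → ℝ := fun p ω =>
    realComponent β (p.1, p.2) (s + τ) ω - realComponent β (p.1, p.2) s ω
  have hD : ∀ p, Measurable (D p) := fun p =>
    (measurable_realComponent hβ _ _).sub (measurable_realComponent hβ _ _)
  have hinj : Function.Injective fun p : Fin N × Bool => ((p.1 : ℕ), p.2) := by
    rintro ⟨a, b⟩ ⟨c, d⟩ h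
    simp only [Prod.mk.injEq] at h
    exact Prod.ext (Fin.ext h.1) h.2
  have hindep : iIndepFun D P :=
    (hβ.independent.precomp hinj).comp (fun _ (f : ℝ≥0 → ℝ) => f (s + τ) - f s)
      (fun _ => (measurable_pi_apply _).sub (measurable_pi_apply _))
  have hlaw : ∀ p, P.map (D p) = gaussianReal 0 τ := fun p => by
    have h := ((hβ.brownian (p.1, p.2)).toIsPreBrownianReal.hasLaw_sub (s + τ) s).map_eq
    have hnn : nndist (s + τ).1 s.1 = τ := by
      ext
      simp
    rw [hnn] at h
    exact h
  have hjoint : P.map (fun ω p => D p ω) = Measure.pi fun _ => gaussianReal 0 τ := by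
    rw [hindep.map_fun_eq_pi_map fun p => (hD p).aemeasurable]
    simp_rw [hlaw]
  let φ : (Bool → ℝ) → ℂ := fun f => ⟨f true, f false⟩
  have hφ : Measurable φ := by
    have : φ = Complex.measurableEquivRealProd.symm ∘ fun f => (f true, f false) := rfl
    rw [this]
    exact (MeasurableEquiv.measurable _).comp (by fun_prop)
  have hcomp : (fun ω (m : Fin N) => β m (s + τ) ω - β m s ω) =
      (fun (f : Fin N → Bool → ℝ) m => φ (f m)) ∘ MeasurableEquiv.curry (Fin N) Bool ℝ ∘
        fun ω p => D p ω := by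
    funext ω m
    apply Complex.ext
    · simp [φ, D, realComponent, MeasurableEquiv.curry, Function.curry]
    · simp [φ, D, realComponent, MeasurableEquiv.curry, Function.curry]
  have hφm : Measurable fun (f : Fin N → Bool → ℝ) m => φ (f m) :=
    measurable_pi_lambda _ fun m => hφ.comp (measurable_pi_apply m)
  have hDm : Measurable fun ω p => D p ω := measurable_pi_lambda _ hD
  rw [hcomp, ← Measure.map_map hφm ((MeasurableEquiv.measurable _).comp hDm),
    ← Measure.map_map (MeasurableEquiv.measurable _) hDm, hjoint]
  have hcurry := Measure.infinitePi_map_curry (ι := Fin N) (κ := Bool)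
    (fun _ _ => gaussianReal 0 τ)
  simp only [Measure.infinitePi_eq_pi] at hcurry
  rw [hcurry]
  have := Measure.pi_map_pi (ι := Fin N) (μ := fun _ => Measure.pi fun _ : Bool => gaussianReal 0 τ)
    (f := fun _ => φ) (hμ := fun _ => by
      rw [map_pi_gaussianReal_bool]; infer_instance) (fun _ => hφ.aemeasurable)
  rw [this]
  simp_rw [φ, map_pi_gaussianReal_bool]

end Wiener

/-! ### The chain in coefficients -/

section CoefficientChain

open scoped BoundedContinuousFunction

variable {N : ℕ}

/-- One step of the scheme in sine coefficients, as a function of the old state and the noise. -/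
noncomputable def coeffStep (s lam τ : ℝ) (p : Coeff N × Coeff N) : Coeff N :=
  eulerSolve s lam τ p.1 (s • p.1 + p.2)

lemma continuous_coeffStep {s lam τ : ℝ} (hlam : lam = -1 ∨ lam = 0 ∨ lam = 1) (hτ : 0 ≤ τ)
    (hs : StepSmall lam τ N) : Continuous (coeffStep (N := N) s lam τ) := by
  have h0 : Continuous fun q : Coeff N × Coeff N => (q.1, s • q.1 + q.2) := by fun_prop
  exact (continuous_eulerSolve hlam hτ hs).comp h0

/-- The transition kernel of the scheme in sine coefficients. -/
noncomputable def coeffKernel (s lam : ℝ) (η : ℕ → ℝ) (τ : ℝ≥0) (N : ℕ) :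
    Kernel (Coeff N) (Coeff N) :=
  randomMapKernel (coeffStep s lam τ) (coeffNoiseLaw η τ N)

variable {s lam : ℝ} {τ : ℝ≥0}

/-- The chain enters `G` when `s • b + w` lies in the preimage of `G` under the solution map. The
noise law, the translation and the solution map all respect Lebesgue null sets both ways. -/
lemma coeffKernel_apply_eq_zero_iff (hlam : lam = -1 ∨ lam = 0 ∨ lam = 1)
    (hs : StepSmall lam τ N) {η : ℕ → ℝ} (hη : ∀ m < N, 0 < η m) (hτ : τ ≠ 0) (b : Coeff N)
    {G : Set (Coeff N)} (hG : MeasurableSet G) :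
    coeffKernel s lam η τ N b G = 0 ↔ coeffVolume η N G = 0 := by
  have := isAddHaarMeasure_coeffVolume hη
  rw [coeffKernel, randomMapKernel_apply'
    (continuous_coeffStep hlam τ.coe_nonneg hs).measurable b hG,
    ← addHaar_eulerSolve_preimage_eq_zero_iff (s := s) hlam τ.coe_nonneg hs (coeffVolume η N) b hG,
    ← measure_preimage_add (coeffVolume η N) (s • b)]
  exact ⟨fun h => absolutelyContinuous_coeffNoiseLaw η hτ h,
    fun h => coeffNoiseLaw_absolutelyContinuous η hτ h⟩

lemma coeffKernel_absolutelyContinuous (hlam : lam = -1 ∨ lam = 0 ∨ lam = 1)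
    (hs : StepSmall lam τ N) {η : ℕ → ℝ} (hη : ∀ m < N, 0 < η m) (hτ : τ ≠ 0) (b : Coeff N) :
    coeffKernel s lam η τ N b ≪ coeffVolume η N :=
  Measure.AbsolutelyContinuous.mk fun _ hG =>
    (coeffKernel_apply_eq_zero_iff hlam hs hη hτ b hG).2

lemma absolutelyContinuous_coeffKernel (hlam : lam = -1 ∨ lam = 0 ∨ lam = 1)
    (hs : StepSmall lam τ N) {η : ℕ → ℝ} (hη : ∀ m < N, 0 < η m) (hτ : τ ≠ 0) (b : Coeff N) :
    coeffVolume η N ≪ coeffKernel s lam η τ N b :=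
  Measure.AbsolutelyContinuous.mk fun _ hG =>
    (coeffKernel_apply_eq_zero_iff hlam hs hη hτ b hG).1

lemma exists_invariant_coeffKernel (hlam : lam = -1 ∨ lam = 0 ∨ lam = 1)
    (hs : StepSmall lam τ N) (η : ℕ → ℝ) (hs0 : 0 ≤ s) (hs1 : s < 1) :
    ∃ μ : Measure (Coeff N), IsProbabilityMeasure μ ∧
      Kernel.Invariant (coeffKernel s lam η τ N) μ := by
  have hcont := continuous_coeffStep (N := N) (s := s) hlam τ.coe_nonneg hs
  have hF := hcont.measurable
  have := isMarkovKernel_randomMapKernel (ν := coeffNoiseLaw η τ N) hF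
  lift s to ℝ≥0 using hs0
  have hs1' : s < 1 := hs1
  set M := ∫⁻ w, ‖w‖ₑ ∂(coeffNoiseLaw η τ N) with hM
  have hMt : M ≠ ∞ := (lintegral_enorm_coeffNoiseLaw_lt_top η τ).ne
  have hpos : 1 - s ≠ 0 := (tsub_pos_of_lt hs1').ne'
  -- `M / (1 - s)` is the fixed point of the moment recursion `C ↦ s C + M`.
  have hC : (s : ℝ≥0∞) * ((M.toNNReal / (1 - s) : ℝ≥0) : ℝ≥0∞) + M ≤
      ((M.toNNReal / (1 - s) : ℝ≥0) : ℝ≥0∞) := by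
    nth_rewrite 2 [← ENNReal.coe_toNNReal hMt]
    rw [← ENNReal.coe_mul, ← ENNReal.coe_add, ENNReal.coe_le_coe]
    apply le_of_eq
    have h1 : M.toNNReal = (1 - s) * (M.toNNReal / (1 - s)) := by
      rw [mul_div_cancel₀ _ hpos]
    nth_rewrite 2 [h1]
    rw [← add_mul, add_tsub_cancel_of_le hs1'.le, one_mul]
  refine exists_invariant_of_feller (κ := randomMapKernel (coeffStep s lam τ)
    (coeffNoiseLaw η τ N)) hC (fun f => ?_) fun b => ?_
  · have hfF : Continuous fun p => f (coeffStep (N := N) s lam τ p) := f.continuous.comp hcont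
    have heq : ∀ b : Coeff N, ∫ z, f z ∂(randomMapKernel (coeffStep s lam τ)
        (coeffNoiseLaw η τ N) b) = ∫ w, f (coeffStep s lam τ (b, w)) ∂(coeffNoiseLaw η τ N) :=
      fun b => by
        rw [randomMapKernel_apply hF, integral_map (by fun_prop)
          f.continuous.aestronglyMeasurable]
    simp_rw [heq]
    refine continuous_of_dominated (bound := fun _ => ‖f‖) (fun b => ?_)
      (fun b => Eventually.of_forall fun w => f.norm_coe_le_norm _) (integrable_const _)
      (Eventually.of_forall fun w => hfF.comp (by fun_prop))
    exact (hfF.comp (by fun_prop)).aestronglyMeasurable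
  · rw [randomMapKernel_apply hF, lintegral_map (by fun_prop) (by fun_prop)]
    calc ∫⁻ w, ‖coeffStep s lam τ (b, w)‖ₑ ∂(coeffNoiseLaw η τ N)
        ≤ ∫⁻ w, s * ‖b‖ₑ + ‖w‖ₑ ∂(coeffNoiseLaw η τ N) := by
          refine lintegral_mono fun w => ?_
          have h1 : ‖coeffStep (s : ℝ) lam τ (b, w)‖ₑ ≤ ‖(s : ℝ) • b + w‖ₑ := by
            rw [enorm_le_iff_norm_le]
            exact norm_eulerSolve_le hlam τ.coe_nonneg hs b _
          refine h1.trans ((enorm_add_le _ _).trans ?_)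
          rw [enorm_smul]
          gcongr
          rw [Real.enorm_of_nonneg s.coe_nonneg, ENNReal.ofReal_coe_nnreal]
      _ = s * ‖b‖ₑ + M := by
          rw [lintegral_add_left measurable_const]
          simp [hM]

end CoefficientChain

/-! ### The chain on the Galerkin space -/

section GalerkinChain

variable {N : ℕ} {α lam : ℝ} {τ : ℝ≥0}

/-- The transition kernel of the scheme on `V_N`. -/
noncomputable def galerkinKernel (α lam : ℝ) (η : ℕ → ℝ) (τ : ℝ≥0) (N : ℕ) :
    Kernel (galerkinSpace N) (galerkinSpace N) :=
  randomMapKernel (fun p => eulerStep α lam τ N p.1 p.2) (noiseLaw η τ N)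

lemma galerkinKernel_coeffEquiv (hlam : lam = -1 ∨ lam = 0 ∨ lam = 1)
    (hs : StepSmall lam τ N) (η : ℕ → ℝ) (b : Coeff N) :
    galerkinKernel α lam η τ N (coeffEquiv N b) =
      (coeffKernel (Real.exp (-α * τ)) lam η τ N b).map (coeffEquiv N) := by
  have hF := (continuous_coeffStep (N := N) (s := Real.exp (-α * τ)) hlam τ.coe_nonneg hs).measurable
  have hG := measurable_eulerStep (α := α) hlam hs
  have hG' : Measurable fun w => eulerStep α lam τ N (coeffEquiv N b) w := by
    have h := hG.comp (measurable_prodMk_left (x := coeffEquiv N b))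
    exact h
  have hF' : Measurable fun w => coeffStep (Real.exp (-α * τ)) lam τ (b, w) :=
    hF.comp measurable_prodMk_left
  rw [galerkinKernel, coeffKernel, randomMapKernel_apply hF, randomMapKernel_apply hG,
    ← map_coeffNoiseLaw, Measure.map_map hG' (coeffEquiv N).measurable,
    Measure.map_map (coeffEquiv N).measurable hF']
  congr 1
  funext w
  simp only [Function.comp_apply, eulerStep, MeasurableEquiv.symm_apply_apply, coeffStep]

lemma isTransitionKernel_galerkinKernel (hlam : lam = -1 ∨ lam = 0 ∨ lam = 1)
    (hs : StepSmall lam τ N) (η : ℕ → ℝ) :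
    IsTransitionKernel α lam η τ N (galerkinKernel α lam η τ N) := by
  intro v G hG
  rw [galerkinKernel, randomMapKernel_apply' (measurable_eulerStep hlam hs) v hG]
  congr 1
  ext w
  simp [isEulerStep_iff hlam hs]

lemma measurable_eulerStep_noise {Ω : Type*} {mX : MeasurableSpace Ω}
    (hlam : lam = -1 ∨ lam = 0 ∨ lam = 1) (hs : StepSmall lam τ N) (η : ℕ → ℝ)
    {X : Ω → galerkinSpace N} {f g : ℕ → Ω → ℂ} (hX : Measurable X) (hf : ∀ m, Measurable (f m))
    (hg : ∀ m, Measurable (g m)) : Measurable fun ω =>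
      eulerStep α lam τ N (X ω) (galerkinNoise η N fun m => f m ω - g m ω) := by
  have h1 : Measurable fun ω (m : Fin N) => f m ω - g m ω :=
    measurable_pi_lambda _ fun m => (hf m).sub (hg m)
  have h2 : Measurable fun ω => (X ω, galerkinNoise η N fun m => f m ω - g m ω) :=
    hX.prodMk ((measurable_galerkinNoise η).comp h1)
  have h3 := (measurable_eulerStep (α := α) hlam hs).comp h2
  exact h3

variable {Ω : Type*} [mΩ : MeasurableSpace Ω] {P : Measure Ω} {ℱ : Filtration ℝ≥0 mΩ}
  {β : ℕ → ℝ≥0 → Ω → ℂ}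

/-- The solution of the scheme, constructed step by step. -/
noncomputable def schemeSolution (α lam : ℝ) (η : ℕ → ℝ) (τ : ℝ≥0) (N : ℕ)
    (β : ℕ → ℝ≥0 → Ω → ℂ) (u₀ : ℝ → ℂ) : ℕ → Ω → galerkinSpace N
  | 0, _ => galerkinProj N u₀
  | k + 1, ω => eulerStep α lam τ N (schemeSolution α lam η τ N β u₀ k ω)
      (galerkinNoise η N fun m => β m ((k + 1 : ℕ) * τ) ω - β m (k * τ) ω)

lemma mul_le_succ_mul (k : ℕ) (τ : ℝ≥0) : (k : ℝ≥0) * τ ≤ ((k + 1 : ℕ) : ℝ≥0) * τ := by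
  gcongr
  exact Nat.le_succ k

lemma isSchemeSolution_schemeSolution (hlam : lam = -1 ∨ lam = 0 ∨ lam = 1)
    (hs : StepSmall lam τ N) (η : ℕ → ℝ) (hβ : IsWienerFamily P ℱ β) (u₀ : ℝ → ℂ) :
    IsSchemeSolution α lam η τ N P ℱ β u₀ (schemeSolution α lam η τ N β u₀) where
  adapted k := by
    induction k with
    | zero => exact measurable_const
    | succ k ih =>
      exact measurable_eulerStep_noise (f := fun m => β m ((k + 1 : ℕ) * τ))
        (g := fun m => β m (k * τ)) hlam hs η
        (ih.mono (ℱ.mono (mul_le_succ_mul k τ)) le_rfl) (fun m => hβ.adapted m _)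
        fun m => (hβ.adapted m _).mono (ℱ.mono (mul_le_succ_mul k τ)) le_rfl
  init := Eventually.of_forall fun _ => rfl
  step k := Eventually.of_forall fun _ => (isEulerStep_iff hlam hs _ _ _).2 rfl

lemma isMarkovChainWith_galerkinKernel [IsProbabilityMeasure P]
    (hlam : lam = -1 ∨ lam = 0 ∨ lam = 1)
    (hs : StepSmall lam τ N) (η : ℕ → ℝ) (hβ : IsWienerFamily P ℱ β) {u₀ : ℝ → ℂ}
    {u : ℕ → Ω → galerkinSpace N} (hu : IsSchemeSolution α lam η τ N P ℱ β u₀ u) :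
    IsMarkovChainWith P ℱ τ (galerkinKernel α lam η τ N) u := by
  intro k G hG
  have hkτ : ((k + 1 : ℕ) : ℝ≥0) * τ = k * τ + τ := by push_cast; ring
  let I : Ω → Fin N → ℂ := fun ω m => β m ((k + 1 : ℕ) * τ) ω - β m (k * τ) ω
  have hI : Measurable I := measurable_pi_lambda _ fun m =>
    ((hβ.adapted m _).mono (ℱ.le _) le_rfl).sub ((hβ.adapted m _).mono (ℱ.le _) le_rfl)
  have hlaw : P.map I = Measure.pi fun _ => complexIncrementLaw τ := by
    rw [← map_wienerIncrement hβ N (k * τ) τ]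
    simp only [I, hkτ]
  refine condExp_randomMap (ℱ.le _) (hu.adapted k) ((hu.adapted (k + 1)).mono (ℱ.le _) le_rfl)
    (Z := fun ω => galerkinNoise η N (I ω)) ((measurable_galerkinNoise η).comp hI) ?_ ?_
    (measurable_eulerStep hlam hs) ?_ hG
  · refine indep_of_indep_of_le_left (hβ.increment_indep _ _ (mul_le_succ_mul k τ)) ?_
    have hr : Measurable fun (f : ℕ → ℂ) => galerkinNoise η N fun m => f m :=
      (measurable_galerkinNoise η).comp (measurable_pi_lambda _ fun m => measurable_pi_apply _)
    exact (hr.comp (comap_measurable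
      (fun ω (m : ℕ) => β m ((k + 1 : ℕ) * τ) ω - β m (k * τ) ω))).comap_le
  · rw [noiseLaw, ← hlaw, Measure.map_map (measurable_galerkinNoise η) hI]
    rfl
  · filter_upwards [hu.step k] with ω hω
    exact (isEulerStep_iff hlam hs _ _ _).1 hω

end GalerkinChain

end DampedNLS

/-! ### The main theorem -/

open DampedNLS in
theorem mainTheorem3
    (α lam : ℝ) (hα : 0 < α) (hlam : lam = -1 ∨ lam = 0 ∨ lam = 1)
    (η : ℕ → ℝ) (hη : ∀ m, 0 ≤ η m) (hη_sum : Summable η) :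
    ∃ τ₀ : ℕ → ℝ≥0, (∀ N, 0 < τ₀ N) ∧
      -- unless `lam = 1`, the threshold does not depend on the dimension
      (lam ≠ 1 → ∀ N M, τ₀ N = τ₀ M) ∧
      ∀ N : ℕ, 1 ≤ N → (∀ m < N, 0 < η m) → ∀ τ : ℝ≥0, 0 < τ → τ < τ₀ N →
        -- the scheme is uniquely solvable
        (∀ v w : galerkinSpace N, ∃! u : galerkinSpace N, IsEulerStep α lam τ N v w u) ∧
        ∃ κ : Kernel (galerkinSpace N) (galerkinSpace N),
          IsMarkovKernel κ ∧ IsTransitionKernel α lam η τ N κ ∧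
          -- its solutions are Markov chains with the transition kernel `κ`
          (∀ (Ω : Type*) [mΩ : MeasurableSpace Ω] (P : Measure Ω) [IsProbabilityMeasure P]
            (ℱ : Filtration ℝ≥0 mΩ) (β : ℕ → ℝ≥0 → Ω → ℂ), IsWienerFamily P ℱ β →
            ∀ u₀ : ℝ → ℂ, MemLp u₀ 2 (volume.restrict (Set.Ioo 0 1)) →
              (∃ u, IsSchemeSolution α lam η τ N P ℱ β u₀ u) ∧
              ∀ u, IsSchemeSolution α lam η τ N P ℱ β u₀ u → IsMarkovChainWith P ℱ τ κ u) ∧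
          -- the chain has a unique invariant probability measure, and it is ergodic
          ∃ μ : Measure (galerkinSpace N),
            IsProbabilityMeasure μ ∧ Kernel.Invariant κ μ ∧
            (∀ ν : Measure (galerkinSpace N),
              IsProbabilityMeasure ν → Kernel.Invariant κ ν → ν = μ) ∧
            IsErgodicFor κ μ := by
  have hden : ∀ N : ℕ, (0 : ℝ) < ((N * Real.pi) ^ 2 + 1)⁻¹ := fun N => by positivity
  -- Below this threshold `τ ((N π)² + 1) < 1`, hence `τ (N π)² < 1`. For the other signs any
  -- positive constant works.
  refine ⟨fun N => if lam = 1 then Real.toNNReal ((N * Real.pi) ^ 2 + 1)⁻¹ else 1, fun N => ?_,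
    fun h N M => by simp [h], fun N _ hηN τ hτ hτ₀ => ?_⟩
  · beta_reduce
    split_ifs
    · exact Real.toNNReal_pos.2 (hden N)
    · exact one_pos
  have hs : StepSmall lam τ N := fun h => by
    beta_reduce at hτ₀
    rw [if_pos h] at hτ₀
    have h1 : (τ : ℝ) < ((N * Real.pi) ^ 2 + 1)⁻¹ := Real.lt_toNNReal_iff_coe_lt.1 hτ₀
    have h2 : (0 : ℝ) < (N * Real.pi) ^ 2 + 1 := by positivity
    have h3 := (lt_inv_comm₀ (by exact_mod_cast hτ) h2).1 h1
    have h4 : (0 : ℝ) < τ := by exact_mod_cast hτ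
    have h5 := mul_lt_mul_of_pos_left h3 h4
    rw [mul_inv_cancel₀ h4.ne'] at h5
    linarith
  have hmk : IsMarkovKernel (galerkinKernel α lam η τ N) :=
    isMarkovKernel_randomMapKernel (measurable_eulerStep hlam hs)
  refine ⟨fun v w => ⟨eulerStep α lam τ N v w, (isEulerStep_iff hlam hs v w _).2 rfl,
    fun u hu => (isEulerStep_iff hlam hs v w u).1 hu⟩, galerkinKernel α lam η τ N, hmk,
    isTransitionKernel_galerkinKernel hlam hs η, fun Ω _ P _ ℱ β hβ u₀ _ =>
      ⟨⟨_, isSchemeSolution_schemeSolution hlam hs η hβ u₀⟩,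
        fun u hu => isMarkovChainWith_galerkinKernel hlam hs η hβ hu⟩, ?_⟩
  have hκ := galerkinKernel_coeffEquiv (α := α) hlam hs η
  have h1 : ∀ v, galerkinKernel α lam η τ N v ≪ (coeffVolume η N).map (coeffEquiv N) := fun v => by
    obtain ⟨b, rfl⟩ := (coeffEquiv N).surjective v
    rw [hκ]
    exact (coeffKernel_absolutelyContinuous hlam hs hηN hτ.ne' b).map (coeffEquiv N).measurable
  have h2 : ∀ v, (coeffVolume η N).map (coeffEquiv N) ≪ galerkinKernel α lam η τ N v := fun v => by
    obtain ⟨b, rfl⟩ := (coeffEquiv N).surjective v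
    rw [hκ]
    exact (absolutelyContinuous_coeffKernel hlam hs hηN hτ.ne' b).map (coeffEquiv N).measurable
  -- The damping enters here: `exp (-α τ) < 1` is the contraction factor of the drift.
  obtain ⟨μ, hμp, hμ⟩ := exists_invariant_coeffKernel (s := Real.exp (-α * τ)) hlam hs η
    (Real.exp_pos _).le (Real.exp_lt_one_iff.2 (by
      have : 0 < α * (τ : ℝ) := mul_pos hα (by exact_mod_cast hτ)
      linarith))
  have hμ' := invariant_map (coeffEquiv N) hκ hμ
  have : IsProbabilityMeasure (μ.map (coeffEquiv N)) :=
    Measure.isProbabilityMeasure_map (coeffEquiv N).measurable.aemeasurable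
  exact ⟨_, this, hμ', fun ν _ hν => invariant_unique h1 h2 hν hμ',
    isErgodicFor_of_equivalent h1 h2 hμ'⟩
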